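/- Let $m\ge 1$ and $p_0,\dots,p_m\in[0,1]$ with $p_k\ne k/m$ for some $0\le k\le m$ (a nonlinear model). Let $G_0$ be a finite (multi)graph each of whose nodes is red or blue. Given $G_n$, the graph $G_{n+1}$ is obtained by adding one new node together with $m$ edges from it to nodes of $G_n$; conditionally on the past, the $m$ endpoints are independent, each equal to a given node $u$ of $G_n$ with probability proportional to the degree of $u$ in $G_n$, and, if exactly $k$ of these $m$ edges lead to red nodes, then the new node becomes red with probability $p_k$ and blue with probability $1-p_k$. Let $A_n,B_n$ be the numbers of red and blue nodes of $G_n$, let $a_n=A_n/(A_n+B_n)$, and let $X_n,Y_n$ be the sums of the degrees of the red and of the blue nodes of $G_n$. Suppose that $X_0>0$ and $Y_0>0$. Let $$P(z)=\frac12\sum_{k=0}^m\binom mk z^k(1-z)^{m-k}\Bigl(p_k-\frac km\Bigr),\qquad Z_P=\{z\in[0,1]:P(z)=0\}.$$ (i) If $z\in Z_P\cap(0,1)$ and there is an $\varepsilon>0$ such that $P<0$ on $(z-\varepsilon,z)$ and $P>0$ on $(z,z+\varepsilon)$, then $\mathbb P(\lim_{n\to\infty}a_n=z)=0$. (ii)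 If $0\in Z_P$ and there is an $\varepsilon>0$ such that $P>0$ on $(0,\varepsilon)$, then $\mathbb P(\lim_{n\to\infty}a_n=0)=0$. (iii) If $1\in Z_P$ and there is an $\varepsilon>0$ such that $P<0$ on $(1-\varepsilon,1)$, then $\mathbb P(\lim_{n\to\infty}a_n=1)=0$. -/

import Mathlib

open MeasureTheory ProbabilityTheory Filter Topology Set

/-- A finite multigraph (loops and parallel edges are allowed) on the node set `Fin size`, in which
every node is coloured red (`true`) or blue (`false`). -/
structure ColoredGraph where
  /-- the number of nodes -/
  size : ℕ
  /-- the edges, with multiplicity -/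
  edges : Multiset (Sym2 (Fin size))
  /-- the colouring -/
  isRed : Fin size → Bool

namespace ColoredGraph

/-- The set of coloured graphs is countable; it carries the discrete σ-algebra. -/
instance : MeasurableSpace ColoredGraph := ⊤

/-- The degree of a node: the number of edge ends at it (a loop counts twice). -/
def degree (G : ColoredGraph) (v : Fin G.size) : ℕ :=
  (G.edges.map fun e => e.toMultiset.count v).sum

/-- `A`: the number of red nodes. -/
def numRed (G : ColoredGraph) : ℕ := ∑ v, if G.isRed v then 1 else 0

/-- `B`: the number of blue nodes. -/
def numBlue (G : ColoredGraph) : ℕ := ∑ v, if G.isRed v then 0 else 1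

/-- `X`: the sum of the degrees of the red nodes. -/
def redDegree (G : ColoredGraph) : ℕ := ∑ v, if G.isRed v then G.degree v else 0

/-- `Y`: the sum of the degrees of the blue nodes. -/
def blueDegree (G : ColoredGraph) : ℕ := ∑ v, if G.isRed v then 0 else G.degree v

/-- `a = A / (A + B)`: the fraction of red nodes. -/
noncomputable def redFraction (G : ColoredGraph) : ℝ :=
  (G.numRed : ℝ) / ((G.numRed : ℝ) + (G.numBlue : ℝ))

/-- The graph obtained by adding a new (last) node of colour `c` together with `m` edges, the
`i`-th of which joins the new node to the existing node `w i`. -/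
def addNode (G : ColoredGraph) {m : ℕ} (w : Fin m → Fin G.size) (c : Bool) : ColoredGraph where
  size := G.size + 1
  edges := G.edges.map (Sym2.map Fin.castSucc) +
    Finset.univ.val.map fun i => s((w i).castSucc, Fin.last G.size)
  isRed := Fin.snoc (α := fun _ => Bool) G.isRed c

/-- The number of red nodes, counted with multiplicity, among the chosen neighbours `w`. -/
def redNeighbors (G : ColoredGraph) {m : ℕ} (w : Fin m → Fin G.size) : ℕ :=
  ∑ i, if G.isRed (w i) then 1 else 0

/-- Linear preferential attachment: the probability that the new node chooses the neighbours `w`.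
The `m` end points are independent, and each of them is a given node with probability proportional
to the degree of that node. -/
noncomputable def attachProb (G : ColoredGraph) {m : ℕ} (w : Fin m → Fin G.size) : ℝ :=
  ∏ i, (G.degree (w i) : ℝ) / ∑ v, (G.degree v : ℝ)

/-- The probability that the new node gets colour `c` when `k` of its neighbours are red. -/
noncomputable def colorProb (p : ℕ → ℝ) (k : ℕ) (c : Bool) : ℝ := if c then p k else 1 - p k

open Classical in
/-- The probability that one step of the process leads from the graph `G` to the graph `H`. -/
noncomputable def transProb (m : ℕ) (p : ℕ → ℝ) (G H : ColoredGraph) : ℝ :=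
  ∑ w : Fin m → Fin G.size, ∑ c : Bool,
    if G.addNode w c = H then G.attachProb w * colorProb p (G.redNeighbors w) c else 0

end ColoredGraph

/-- `G 0, G 1, …` is the preferential attachment process with type adoption started from `G₀`, with
`m` edges added in each step and adoption probabilities `p 0, …, p m`, relative to a filtration: it
is adapted, starts almost surely from `G₀`, and is Markov with transition probabilities
`ColoredGraph.transProb m p`. -/
structure IsTypeAdoptionProcess {Ω : Type*} [mΩ : MeasurableSpace Ω] (μ : Measure Ω)
    (ℱ : Filtration ℕ mΩ) (m : ℕ) (p : ℕ → ℝ) (G₀ : ColoredGraph) (G : ℕ → Ω → ColoredGraph) :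
    Prop where
  adapted : ∀ n, Measurable[ℱ n] (G n)
  init : ∀ᵐ ω ∂μ, G 0 ω = G₀
  step : ∀ (n : ℕ) (H : ColoredGraph),
    μ⟦{ω | G (n + 1) ω = H}|ℱ n⟧ =ᵐ[μ] fun ω => (G n ω).transProb m p H

/-- `P(z) = (1/2) ∑_{k=0}^m (m choose k) z^k (1 - z)^(m-k) (p_k - k/m)`. -/
noncomputable def driftPoly (m : ℕ) (p : ℕ → ℝ) (z : ℝ) : ℝ :=
  (1 / 2) * ∑ k ∈ Finset.range (m + 1),
    (m.choose k : ℝ) * z ^ k * (1 - z) ^ (m - k) * (p k - (k : ℝ) / (m : ℝ))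

/-- `Z_P`: the zeros of `P` in `[0, 1]`. -/
def driftZeros (m : ℕ) (p : ℕ → ℝ) : Set ℝ := {z | z ∈ Icc (0 : ℝ) 1 ∧ driftPoly m p z = 0}

/-- The expectation of `g k` for a binomial variable `k` with parameters `m` and `x`. -/
noncomputable def binomialMean (m : ℕ) (x : ℝ) (g : ℕ → ℝ) : ℝ :=
  ∑ k ∈ Finset.range (m + 1), (m.choose k : ℝ) * x ^ k * (1 - x) ^ (m - k) * g k

theorem binomialMean_add (m : ℕ) (x : ℝ) (f g : ℕ → ℝ) :
    binomialMean m x (fun k => f k + g k) = binomialMean m x f + binomialMean m x g := by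
  simp only [binomialMean, ← Finset.sum_add_distrib]
  exact Finset.sum_congr rfl fun k _ => by ring

theorem binomialMean_const_mul (m : ℕ) (x a : ℝ) (g : ℕ → ℝ) :
    binomialMean m x (fun k => a * g k) = a * binomialMean m x g := by
  simp only [binomialMean, Finset.mul_sum]
  exact Finset.sum_congr rfl fun k _ => by ring

theorem binomialMean_const (m : ℕ) (x a : ℝ) : binomialMean m x (fun _ => a) = a := by
  have h := add_pow x (1 - x) m
  simp only [add_sub_cancel, one_pow] at h
  rw [binomialMean, ← Finset.sum_mul]
  conv_rhs => rw [← one_mul a, h]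
  exact congrArg (· * a) (Finset.sum_congr rfl fun k _ => by ring)

theorem binomialMean_id (m : ℕ) (x : ℝ) : binomialMean m x (fun k => (k : ℝ)) = m * x := by
  have h := congrArg (Polynomial.eval x) (bernsteinPolynomial.sum_smul ℝ m)
  simp only [Polynomial.eval_finsetSum, bernsteinPolynomial, nsmul_eq_mul, Polynomial.eval_mul,
    Polynomial.eval_natCast, Polynomial.eval_pow, Polynomial.eval_X, Polynomial.eval_sub,
    Polynomial.eval_one] at h
  rw [← h]
  exact Finset.sum_congr rfl fun k _ => by ring

theorem binomialMean_mono {m : ℕ} {x : ℝ} (h0 : 0 ≤ x) (h1 : x ≤ 1) {f g : ℕ → ℝ}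
    (h : ∀ k ≤ m, f k ≤ g k) : binomialMean m x f ≤ binomialMean m x g := by
  refine Finset.sum_le_sum fun k hk => ?_
  have : 0 ≤ 1 - x := by linarith
  exact mul_le_mul_of_nonneg_left (h k (by simpa [Nat.lt_succ_iff] using hk)) (by positivity)

theorem driftPoly_eq_binomialMean {m : ℕ} (hm : 1 ≤ m) (p : ℕ → ℝ) (x : ℝ) :
    2 * m * driftPoly m p x = m * binomialMean m x p - m * x := by
  have hm' : (m : ℝ) ≠ 0 := by positivity
  have h : driftPoly m p x = 1 / 2 * binomialMean m x (fun k => p k + (-1 / (m : ℝ)) * k) := by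
    rw [driftPoly, binomialMean]
    congr 1
    exact Finset.sum_congr rfl fun k _ => by ring
  rw [h, binomialMean_add, binomialMean_const_mul, binomialMean_id]
  field_simp
  ring

namespace ColoredGraph

/-- The sum of all degrees. -/
def totalDegree (G : ColoredGraph) : ℕ := G.redDegree + G.blueDegree

/-- The share of the red nodes in the sum of all degrees. -/
noncomputable def redShare (G : ColoredGraph) : ℝ := (G.redDegree : ℝ) / G.totalDegree

theorem sum_degree (G : ColoredGraph) : ∑ v, G.degree v = G.totalDegree := by
  rw [totalDegree, redDegree, blueDegree, ← Finset.sum_add_distrib]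
  exact Finset.sum_congr rfl fun v _ => by split_ifs <;> simp

theorem numRed_add_numBlue (G : ColoredGraph) : G.numRed + G.numBlue = G.size := by
  rw [numRed, numBlue, ← Finset.sum_add_distrib]
  calc _ = ∑ v : Fin G.size, 1 := Finset.sum_congr rfl fun v _ => by split_ifs <;> simp
    _ = _ := by simp

section addNode

variable (G : ColoredGraph) {m : ℕ} (w : Fin m → Fin G.size) (c : Bool)

theorem degree_addNode_castSucc (v : Fin G.size) :
    (G.addNode w c).degree v.castSucc = G.degree v + ∑ i, if w i = v then 1 else 0 := by
  have h1 : ∀ e : Sym2 (Fin G.size),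
      (Sym2.map Fin.castSucc e).toMultiset.count v.castSucc = e.toMultiset.count v := by
    intro e
    induction e with
    | _ a b => simp [Sym2.toMultiset, List.count_cons]
  have h2 : ∀ i, (s((w i).castSucc, Fin.last G.size)).toMultiset.count v.castSucc =
      if w i = v then 1 else 0 := by
    intro i
    have : Fin.last G.size ≠ v.castSucc := (Fin.castSucc_lt_last v).ne'
    simp [Sym2.toMultiset, List.count_cons, this]
  simp only [degree, addNode, Multiset.map_add, Multiset.map_map, Function.comp_def,
    Multiset.sum_add]
  exact congrArg₂ (· + ·) (congrArg _ (Multiset.map_congr rfl fun e _ => h1 e))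
    (congrArg _ (Multiset.map_congr rfl fun i _ => h2 i))

theorem degree_addNode_last : (G.addNode w c).degree (Fin.last G.size) = m := by
  have h1 : ∀ e : Sym2 (Fin G.size),
      (Sym2.map Fin.castSucc e).toMultiset.count (Fin.last G.size) = 0 := by
    intro e
    induction e with
    | _ a b =>
      simp [Sym2.toMultiset, (Fin.castSucc_lt_last a).ne, (Fin.castSucc_lt_last b).ne]
  have h2 : ∀ i, (s((w i).castSucc, Fin.last G.size)).toMultiset.count (Fin.last G.size) = 1 := by
    intro i
    simp [Sym2.toMultiset, (Fin.castSucc_lt_last (w i)).ne]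
  simp only [degree, addNode, Multiset.map_add, Multiset.map_map, Function.comp_def,
    Multiset.sum_add]
  refine (congrArg₂ (· + ·) (congrArg _ (Multiset.map_congr rfl fun e _ => h1 e))
    (congrArg _ (Multiset.map_congr rfl fun i _ => h2 i))).trans ?_
  simp

@[simp] theorem isRed_addNode_castSucc (v : Fin G.size) :
    (G.addNode w c).isRed v.castSucc = G.isRed v :=
  Fin.snoc_castSucc (α := fun _ => Bool) ..

@[simp] theorem isRed_addNode_last : (G.addNode w c).isRed (Fin.last G.size) = c :=
  Fin.snoc_last (α := fun _ => Bool) ..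

theorem numRed_addNode : (G.addNode w c).numRed = G.numRed + if c then 1 else 0 := by
  rw [numRed]
  erw [Fin.sum_univ_castSucc]
  simp only [isRed_addNode_castSucc, isRed_addNode_last]
  rfl

theorem size_addNode : (G.addNode w c).size = G.size + 1 := rfl

theorem redDegree_addNode :
    (G.addNode w c).redDegree = G.redDegree + G.redNeighbors w + if c then m else 0 := by
  rw [redDegree]
  erw [Fin.sum_univ_castSucc]
  simp only [isRed_addNode_castSucc, isRed_addNode_last, degree_addNode_castSucc,
    degree_addNode_last]
  have h : ∀ v, (if G.isRed v then G.degree v + ∑ i, (if w i = v then 1 else 0) else 0) =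
      (if G.isRed v then G.degree v else 0) +
        ∑ i, (if w i = v then (if G.isRed v then 1 else 0) else 0) := by
    intro v; split_ifs <;> simp
  simp only [h, Finset.sum_add_distrib]
  rw [Finset.sum_comm]
  simp [redDegree, redNeighbors]

theorem totalDegree_addNode : (G.addNode w c).totalDegree = G.totalDegree + 2 * m := by
  rw [← sum_degree]
  erw [Fin.sum_univ_castSucc]
  simp only [degree_addNode_castSucc, degree_addNode_last, Finset.sum_add_distrib, sum_degree]
  rw [Finset.sum_comm]
  simp
  ring

theorem redNeighbors_le : G.redNeighbors w ≤ m := by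
  calc _ ≤ ∑ _i : Fin m, 1 := Finset.sum_le_sum fun i _ => by split_ifs <;> simp
    _ = m := by simp

theorem blueDegree_addNode :
    (G.addNode w c).blueDegree + G.redNeighbors w = G.blueDegree + m + if c then 0 else m := by
  have h1 := totalDegree_addNode G w c
  have h2 := redDegree_addNode G w c
  simp only [totalDegree] at h1
  cases c <;> simp_all <;> omega

end addNode

/-- The expectation of `f` after one step from the graph `G`. -/
noncomputable def stepMean (m : ℕ) (p : ℕ → ℝ) (G : ColoredGraph) (f : ColoredGraph → ℝ) : ℝ :=
  ∑ w : Fin m → Fin G.size, ∑ c : Bool,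
    G.attachProb w * colorProb p (G.redNeighbors w) c * f (G.addNode w c)

theorem attachProb_nonneg (G : ColoredGraph) {m : ℕ} (w : Fin m → Fin G.size) :
    0 ≤ G.attachProb w :=
  Finset.prod_nonneg fun _ _ => by positivity

theorem colorProb_nonneg {m : ℕ} {p : ℕ → ℝ} (hp : ∀ k ≤ m, p k ∈ Icc (0 : ℝ) 1) {k : ℕ}
    (hk : k ≤ m) (c : Bool) : 0 ≤ colorProb p k c := by
  have := hp k hk
  cases c <;> simp [colorProb, this.1, this.2]

theorem redShare_nonneg (G : ColoredGraph) : 0 ≤ G.redShare := by unfold redShare; positivity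

theorem redShare_le_one (G : ColoredGraph) : G.redShare ≤ 1 := by
  unfold redShare
  refine div_le_one_of_le₀ ?_ (by positivity)
  exact_mod_cast Nat.le_add_right _ _

/-- The number of red neighbours of the new node is binomially distributed. -/
theorem sum_attachProb (G : ColoredGraph) (hS : 0 < G.totalDegree) (m : ℕ) (g : ℕ → ℝ) :
    ∑ w : Fin m → Fin G.size, G.attachProb w * g (G.redNeighbors w) =
      binomialMean m G.redShare g := by
  classical
  have hS' : (G.totalDegree : ℝ) ≠ 0 := by positivity
  have hsum : ∑ v, (G.degree v : ℝ) = G.totalDegree := by exact_mod_cast G.sum_degree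
  have hred : ∑ v with G.isRed v = true, (G.degree v : ℝ) / G.totalDegree = G.redShare := by
    rw [← Finset.sum_div, redShare, redDegree, Finset.sum_filter]
    push_cast
    rfl
  have hblue : ∑ v with G.isRed v = false, (G.degree v : ℝ) / G.totalDegree = 1 - G.redShare := by
    rw [eq_sub_iff_add_eq', ← hred]
    have := Finset.sum_filter_add_sum_filter_not Finset.univ (fun v => G.isRed v = true)
      (fun v => (G.degree v : ℝ) / G.totalDegree)
    simp only [Bool.not_eq_true] at this
    rw [this, ← Finset.sum_div, hsum, div_self hS']
  rw [← Finset.sum_fiberwise (s := Finset.univ)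
    (g := fun w : Fin m → Fin G.size => Finset.univ.filter fun i => G.isRed (w i) = true)]
  have hkey : ∀ s : Finset (Fin m),
      ∑ w : Fin m → Fin G.size with (Finset.univ.filter fun i => G.isRed (w i) = true) = s,
        G.attachProb w * g (G.redNeighbors w) =
      G.redShare ^ s.card * (1 - G.redShare) ^ (m - s.card) * g s.card := by
    intro s
    have hset : (Finset.univ.filter fun w : Fin m → Fin G.size =>
        (Finset.univ.filter fun i => G.isRed (w i) = true) = s) =
        Fintype.piFinset fun i => Finset.univ.filter fun v => G.isRed v = decide (i ∈ s) := by
      ext w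
      simp only [Finset.mem_filter, Finset.mem_univ, true_and, Fintype.mem_piFinset,
        Finset.ext_iff]
      refine forall_congr' fun i => ?_
      by_cases h : i ∈ s <;> simp [h]
    have hg : ∀ w ∈ (Finset.univ.filter fun w : Fin m → Fin G.size =>
        (Finset.univ.filter fun i => G.isRed (w i) = true) = s),
        G.attachProb w * g (G.redNeighbors w) = G.attachProb w * g s.card := by
      intro w hw
      simp only [Finset.mem_filter, Finset.mem_univ, true_and] at hw
      rw [← hw, Finset.card_filter, redNeighbors]
    rw [Finset.sum_congr rfl hg, ← Finset.sum_mul, hset]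
    simp only [attachProb, hsum]
    rw [← Finset.prod_univ_sum (fun i => Finset.univ.filter fun v => G.isRed v = decide (i ∈ s))
      (fun _ v => (G.degree v : ℝ) / G.totalDegree)]
    have : ∀ i : Fin m, ∑ v with G.isRed v = decide (i ∈ s), (G.degree v : ℝ) / G.totalDegree =
        if i ∈ s then G.redShare else 1 - G.redShare := by
      intro i
      by_cases h : i ∈ s <;> simp [h, hred, hblue]
    simp only [this]
    rw [Finset.prod_ite]
    simp [Finset.filter_not, Finset.card_sdiff]
  rw [Finset.sum_congr rfl fun s _ => hkey s, ← Finset.powerset_univ,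
    Finset.sum_powerset_apply_card
      (fun k => G.redShare ^ k * (1 - G.redShare) ^ (m - k) * g k), Finset.card_univ,
    Fintype.card_fin, binomialMean]
  exact Finset.sum_congr rfl fun k _ => by rw [nsmul_eq_mul]; ring

theorem stepMean_eq_binomialMean (G : ColoredGraph) (hS : 0 < G.totalDegree) (m : ℕ) (p : ℕ → ℝ)
    {f : ColoredGraph → ℝ} (g : ℕ → Bool → ℝ)
    (h : ∀ (w : Fin m → Fin G.size) c, f (G.addNode w c) = g (G.redNeighbors w) c) :
    stepMean m p G f =
      binomialMean m G.redShare fun k => p k * g k true + (1 - p k) * g k false := by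
  rw [← sum_attachProb G hS, stepMean]
  refine Finset.sum_congr rfl fun w _ => ?_
  simp [h, colorProb]
  ring

theorem stepMean_mono {m : ℕ} {p : ℕ → ℝ} (hp : ∀ k ≤ m, p k ∈ Icc (0 : ℝ) 1) (G : ColoredGraph)
    {f g : ColoredGraph → ℝ}
    (h : ∀ (w : Fin m → Fin G.size) c, f (G.addNode w c) ≤ g (G.addNode w c)) :
    stepMean m p G f ≤ stepMean m p G g :=
  Finset.sum_le_sum fun w _ => Finset.sum_le_sum fun c _ =>
    mul_le_mul_of_nonneg_left (h w c)
      (mul_nonneg (attachProb_nonneg G w) (colorProb_nonneg hp (redNeighbors_le G w) c))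

theorem stepMean_nonneg {m : ℕ} {p : ℕ → ℝ} (hp : ∀ k ≤ m, p k ∈ Icc (0 : ℝ) 1) (G : ColoredGraph)
    {f : ColoredGraph → ℝ} (h : ∀ (w : Fin m → Fin G.size) c, 0 ≤ f (G.addNode w c)) :
    0 ≤ stepMean m p G f :=
  Finset.sum_nonneg fun w _ => Finset.sum_nonneg fun c _ => mul_nonneg
    (mul_nonneg (attachProb_nonneg G w) (colorProb_nonneg hp (redNeighbors_le G w) c)) (h w c)

theorem stepMean_add (m : ℕ) (p : ℕ → ℝ) (G : ColoredGraph) (f g : ColoredGraph → ℝ) :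
    stepMean m p G (fun H => f H + g H) = stepMean m p G f + stepMean m p G g := by
  simp only [stepMean, ← Finset.sum_add_distrib]
  exact Finset.sum_congr rfl fun w _ => Finset.sum_congr rfl fun c _ => by ring

theorem stepMean_const_mul (m : ℕ) (p : ℕ → ℝ) (G : ColoredGraph) (a : ℝ) (f : ColoredGraph → ℝ) :
    stepMean m p G (fun H => a * f H) = a * stepMean m p G f := by
  simp only [stepMean, Finset.mul_sum]
  exact Finset.sum_congr rfl fun w _ => Finset.sum_congr rfl fun c _ => by ring

theorem stepMean_const {m : ℕ} (p : ℕ → ℝ) {G : ColoredGraph} (hS : 0 < G.totalDegree) (a : ℝ) :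
    stepMean m p G (fun _ => a) = a := by
  rw [stepMean_eq_binomialMean G hS m p (fun _ _ => a) fun _ _ => rfl]
  convert binomialMean_const m G.redShare a using 2
  ext k
  ring

theorem stepMean_redDegree {m : ℕ} (hm : 1 ≤ m) (p : ℕ → ℝ) {G : ColoredGraph}
    (hS : 0 < G.totalDegree) :
    stepMean m p G (fun H => (H.redDegree : ℝ)) =
      G.redDegree + 2 * m * G.redShare + 2 * m * driftPoly m p G.redShare := by
  rw [stepMean_eq_binomialMean G hS m p
    (fun k c => (G.redDegree : ℝ) + k + if c then (m : ℝ) else 0)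
    fun w c => by rw [redDegree_addNode]; push_cast; rfl]
  have : (fun k : ℕ => p k * ((G.redDegree : ℝ) + k + if true then (m : ℝ) else 0) +
      (1 - p k) * ((G.redDegree : ℝ) + k + if false then (m : ℝ) else 0)) =
      fun k : ℕ => (G.redDegree : ℝ) + (k + m * p k) := by
    ext k; simp; ring
  simp only [Bool.false_eq_true] at this ⊢
  rw [this, binomialMean_add, binomialMean_add, binomialMean_const, binomialMean_id,
    binomialMean_const_mul, driftPoly_eq_binomialMean hm]
  ring

end ColoredGraph

namespace ColoredGraph

instance : Countable ColoredGraph :=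
  Function.Injective.countable
    (f := fun G : ColoredGraph => (⟨G.size, (G.edges, G.isRed)⟩ :
      Σ n, Multiset (Sym2 (Fin n)) × (Fin n → Bool))) fun G H h => by
    cases G; cases H
    simp only [Sigma.mk.injEq] at h
    obtain ⟨rfl, h⟩ := h
    simp_all

instance : MeasurableSingletonClass ColoredGraph := ⟨fun _ => trivial⟩

theorem transProb_nonneg {m : ℕ} {p : ℕ → ℝ} (hp : ∀ k ≤ m, p k ∈ Icc (0 : ℝ) 1)
    (G H : ColoredGraph) : 0 ≤ G.transProb m p H := by
  refine Finset.sum_nonneg fun w _ => Finset.sum_nonneg fun c _ => ?_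
  split_ifs
  · exact mul_nonneg (attachProb_nonneg G w) (colorProb_nonneg hp (redNeighbors_le G w) c)
  · exact le_rfl

theorem tsum_transProb {m : ℕ} {p : ℕ → ℝ} (hp : ∀ k ≤ m, p k ∈ Icc (0 : ℝ) 1)
    (G : ColoredGraph) {f : ColoredGraph → ℝ} (hf : ∀ H, 0 ≤ f H) :
    ∑' H, ENNReal.ofReal (f H) * ENNReal.ofReal (G.transProb m p H) =
      ENNReal.ofReal (stepMean m p G f) := by
  classical
  have h0 : ∀ (w : Fin m → Fin G.size) (c : Bool),
      0 ≤ G.attachProb w * colorProb p (G.redNeighbors w) c := fun w c =>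
    mul_nonneg (attachProb_nonneg G w) (colorProb_nonneg hp (redNeighbors_le G w) c)
  have h1 : ∀ H, ENNReal.ofReal (f H) * ENNReal.ofReal (G.transProb m p H) =
      ∑ w : Fin m → Fin G.size, ∑ c : Bool, if H = G.addNode w c then
        ENNReal.ofReal (G.attachProb w * colorProb p (G.redNeighbors w) c *
          f (G.addNode w c)) else 0 := by
    intro H
    rw [← ENNReal.ofReal_mul (hf H), transProb, Finset.mul_sum,
      ENNReal.ofReal_sum_of_nonneg]
    · refine Finset.sum_congr rfl fun w _ => ?_
      rw [Finset.mul_sum, ENNReal.ofReal_sum_of_nonneg]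
      · refine Finset.sum_congr rfl fun c _ => ?_
        by_cases h : H = G.addNode w c
        · rw [if_pos h.symm, if_pos h, h, mul_comm]
        · rw [if_neg (fun h' => h h'.symm), if_neg h, mul_zero, ENNReal.ofReal_zero]
      · intro c _
        split_ifs
        exacts [mul_nonneg (hf H) (h0 w c), by simp]
    · intro w _
      refine mul_nonneg (hf H) (Finset.sum_nonneg fun c _ => ?_)
      split_ifs
      exacts [h0 w c, le_rfl]
  simp only [h1]
  rw [Summable.tsum_finsetSum fun _ _ => ENNReal.summable, stepMean,
    ENNReal.ofReal_sum_of_nonneg fun w _ => Finset.sum_nonneg fun c _ =>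
      mul_nonneg (h0 w c) (hf _)]
  refine Finset.sum_congr rfl fun w _ => ?_
  rw [Summable.tsum_finsetSum fun _ _ => ENNReal.summable,
    ENNReal.ofReal_sum_of_nonneg fun c _ => mul_nonneg (h0 w c) (hf _)]
  exact Finset.sum_congr rfl fun c _ => tsum_ite_eq ..

end ColoredGraph

open ColoredGraph

namespace IsTypeAdoptionProcess

variable {Ω : Type*} [mΩ : MeasurableSpace Ω] {μ : Measure Ω}
  {ℱ : Filtration ℕ mΩ} {m : ℕ} {p : ℕ → ℝ} {G₀ : ColoredGraph} {G : ℕ → Ω → ColoredGraph}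

theorem measurable (hG : IsTypeAdoptionProcess μ ℱ m p G₀ G) (n : ℕ) : Measurable (G n) :=
  (hG.adapted n).mono (ℱ.le n) le_rfl

variable [IsProbabilityMeasure μ]

theorem setLIntegral_succ (hG : IsTypeAdoptionProcess μ ℱ m p G₀ G)
    (hp : ∀ k ≤ m, p k ∈ Icc (0 : ℝ) 1) (n : ℕ) {A : Set Ω} (hA : MeasurableSet[ℱ n] A)
    {f : ColoredGraph → ℝ} (hf : ∀ H, 0 ≤ f H) :
    ∫⁻ ω in A, ENNReal.ofReal (f (G (n + 1) ω)) ∂μ =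
      ∫⁻ ω in A, ENNReal.ofReal (stepMean m p (G n ω) f) ∂μ := by
  have hA' : MeasurableSet A := ℱ.le n _ hA
  have hmass : ∀ H, μ (G (n + 1) ⁻¹' {H} ∩ A) =
      ∫⁻ ω in A, ENNReal.ofReal ((G n ω).transProb m p H) ∂μ := by
    intro H
    have hs : MeasurableSet {ω | G (n + 1) ω = H} :=
      hG.measurable (n + 1) (measurableSet_singleton H)
    have hind : Integrable ({ω | G (n + 1) ω = H}.indicator fun _ => (1 : ℝ)) μ :=
      (integrable_const _).indicator hs
    have hint : Integrable (fun ω => (G n ω).transProb m p H) μ :=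
      integrable_condExp.congr (hG.step n H)
    rw [← ofReal_integral_eq_lintegral_ofReal hint.integrableOn
      (ae_of_all _ fun ω => transProb_nonneg hp _ _),
      ← setIntegral_congr_ae hA' ((hG.step n H).mono fun ω h _ => h),
      setIntegral_condExp (ℱ.le n) hind hA, integral_indicator hs]
    simp only [integral_const, smul_eq_mul, mul_one, Measure.real, Measure.restrict_apply_univ,
      Measure.restrict_restrict hs]
    rw [ENNReal.ofReal_toReal (measure_ne_top _ _)]
    rfl
  have hmeas : ∀ g : ColoredGraph → ENNReal, ∀ k, Measurable fun ω => g (G k ω) :=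
    fun g k => (measurable_from_top (f := g)).comp (hG.measurable k)
  calc ∫⁻ ω in A, ENNReal.ofReal (f (G (n + 1) ω)) ∂μ
      = ∫⁻ H, ENNReal.ofReal (f H) ∂((μ.restrict A).map (G (n + 1))) :=
        (lintegral_map (measurable_from_top (f := fun H => ENNReal.ofReal (f H)))
          (hG.measurable _)).symm
    _ = ∑' H, ENNReal.ofReal (f H) * μ (G (n + 1) ⁻¹' {H} ∩ A) := by
        rw [lintegral_countable']
        refine tsum_congr fun H => ?_
        rw [Measure.map_apply (hG.measurable _) (measurableSet_singleton H),
          Measure.restrict_apply (hG.measurable _ (measurableSet_singleton H))]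
    _ = ∑' H, ∫⁻ ω in A, ENNReal.ofReal (f H) *
          ENNReal.ofReal ((G n ω).transProb m p H) ∂μ := by
        refine tsum_congr fun H => ?_
        rw [hmass, lintegral_const_mul]
        exact hmeas (fun K => ENNReal.ofReal (K.transProb m p H)) n
    _ = ∫⁻ ω in A, ∑' H, ENNReal.ofReal (f H) *
          ENNReal.ofReal ((G n ω).transProb m p H) ∂μ := by
        refine (lintegral_tsum fun H => ?_).symm
        exact (hmeas (fun K => ENNReal.ofReal (f H) *
          ENNReal.ofReal (K.transProb m p H)) n).aemeasurable
    _ = _ := lintegral_congr fun ω => tsum_transProb hp _ hf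

theorem setLIntegral_pair (hG : IsTypeAdoptionProcess μ ℱ m p G₀ G)
    (hp : ∀ k ≤ m, p k ∈ Icc (0 : ℝ) 1) (n : ℕ) {A : Set Ω} (hA : MeasurableSet[ℱ n] A)
    {f : ColoredGraph → ColoredGraph → ℝ} (hf : ∀ H K, 0 ≤ f H K) :
    ∫⁻ ω in A, ENNReal.ofReal (f (G n ω) (G (n + 1) ω)) ∂μ =
      ∫⁻ ω in A, ENNReal.ofReal (stepMean m p (G n ω) (f (G n ω))) ∂μ := by
  have hpart : A = ⋃ H, A ∩ G n ⁻¹' {H} := by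
    rw [← inter_iUnion, ← preimage_iUnion, iUnion_of_singleton, preimage_univ, inter_univ]
  have hmeas : ∀ H, MeasurableSet[ℱ n] (A ∩ G n ⁻¹' {H}) := fun H =>
    hA.inter (hG.adapted n (measurableSet_singleton H))
  have hdisj : Pairwise (Function.onFun Disjoint fun H => A ∩ G n ⁻¹' {H}) := by
    intro H K hHK
    refine Set.disjoint_left.2 fun ω h1 h2 => hHK ?_
    exact h1.2.symm.trans h2.2
  rw [hpart, lintegral_iUnion (fun H => ℱ.le n _ (hmeas H)) hdisj,
    lintegral_iUnion (fun H => ℱ.le n _ (hmeas H)) hdisj]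
  refine tsum_congr fun H => ?_
  have hcongr : ∀ g : ColoredGraph → Ω → ENNReal,
      ∫⁻ ω in A ∩ G n ⁻¹' {H}, g (G n ω) ω ∂μ = ∫⁻ ω in A ∩ G n ⁻¹' {H}, g H ω ∂μ :=
    fun g => setLIntegral_congr_fun (ℱ.le n _ (hmeas H)) fun ω hω => by
      have : G n ω = H := hω.2
      simp only [this]
  rw [hcongr fun K ω => ENNReal.ofReal (f K (G (n + 1) ω)),
    setLIntegral_succ hG hp n (hmeas H) (hf H), ← hcongr fun K ω =>
      ENNReal.ofReal (stepMean m p (G n ω) (f K))]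

/-- Almost every path starts from `G₀` and moves along possible transitions. -/
theorem ae_path (hG : IsTypeAdoptionProcess μ ℱ m p G₀ G) (hp : ∀ k ≤ m, p k ∈ Icc (0 : ℝ) 1) :
    ∀ᵐ ω ∂μ, G 0 ω = G₀ ∧ ∀ n, ∃ (w : Fin m → Fin (G n ω).size) (c : Bool),
      G (n + 1) ω = (G n ω).addNode w c := by
  classical
  refine hG.init.and (ae_all_iff.2 fun n => ?_)
  obtain ⟨f, hf0, hf1⟩ : ∃ f : ColoredGraph → ColoredGraph → ℝ,
      (∀ (H : ColoredGraph) (w : Fin m → Fin H.size) (c : Bool), f H (H.addNode w c) = 0) ∧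
      ∀ H K : ColoredGraph, (¬∃ (w : Fin m → Fin H.size) (c : Bool), K = H.addNode w c) → f H K = 1 :=
    ⟨fun H K => if ∃ (w : Fin m → Fin H.size) (c : Bool), K = H.addNode w c then 0 else 1,
      fun H w c => if_pos ⟨w, c, rfl⟩, fun H K h => if_neg h⟩
  have hf : ∀ H K, 0 ≤ f H K := fun H K => by
    by_cases h : ∃ (w : Fin m → Fin H.size) (c : Bool), K = H.addNode w c
    · obtain ⟨w, c, rfl⟩ := h
      exact (hf0 H w c).ge
    · simp [hf1 H K h]
  have h := setLIntegral_pair hG hp n MeasurableSet.univ hf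
  have h0 : ∀ H, stepMean m p H (f H) = 0 := fun H =>
    Finset.sum_eq_zero fun w _ => Finset.sum_eq_zero fun c _ => by rw [hf0, mul_zero]
  simp only [h0, ENNReal.ofReal_zero, lintegral_zero, Measure.restrict_univ] at h
  have hmeas : Measurable fun ω => ENNReal.ofReal (f (G n ω) (G (n + 1) ω)) :=
    (measurable_of_countable fun q : ColoredGraph × ColoredGraph =>
      ENNReal.ofReal (f q.1 q.2)).comp ((hG.measurable n).prodMk (hG.measurable (n + 1)))
  filter_upwards [(lintegral_eq_zero_iff hmeas).1 h] with ω hω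
  by_contra hne
  simp [hf1 _ _ hne] at hω

theorem ae_totalDegree (hG : IsTypeAdoptionProcess μ ℱ m p G₀ G)
    (hp : ∀ k ≤ m, p k ∈ Icc (0 : ℝ) 1) :
    ∀ᵐ ω ∂μ, ∀ n, (G n ω).totalDegree = G₀.totalDegree + 2 * m * n := by
  filter_upwards [ae_path hG hp] with ω hω n
  induction n with
  | zero => simp [hω.1]
  | succ n ih =>
    obtain ⟨w, c, h⟩ := hω.2 n
    rw [h, totalDegree_addNode, ih]
    ring

/-- A nonnegative function `ψ` that decreases on average while the process is in the window `W`
bounds the probability that the process stays in `W` and `ψ` tends to `c`. -/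
theorem mul_measure_le_of_stepMean_le (hG : IsTypeAdoptionProcess μ ℱ m p G₀ G)
    (hp : ∀ k ≤ m, p k ∈ Icc (0 : ℝ) 1) {ψ : ColoredGraph → ℝ} (hψ : ∀ H, 0 ≤ ψ H)
    {W : Set ColoredGraph} (hW : ∀ H ∈ W, stepMean m p H ψ ≤ ψ H) (N : ℕ) {E : Set Ω}
    {c : ENNReal} (hE : ∀ᵐ ω ∂μ, ω ∈ E → (∀ n, N ≤ n → G n ω ∈ W) ∧
      Tendsto (fun n => ENNReal.ofReal (ψ (G n ω))) atTop (𝓝 c)) :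
    c * μ E ≤ ∫⁻ ω in G N ⁻¹' W, ENNReal.ofReal (ψ (G N ω)) ∂μ := by
  let C : ℕ → Set Ω := fun n => {ω | ∀ j, N ≤ j → j ≤ n → G j ω ∈ W}
  have hmem : ∀ n ω, ω ∈ C n ↔ ∀ j, N ≤ j → j ≤ n → G j ω ∈ W := fun n ω => Iff.rfl
  have hWm : ∀ j n, j ≤ n → MeasurableSet[ℱ n] (G j ⁻¹' W) := fun j n hjn =>
    ℱ.mono hjn _ (hG.adapted j trivial)
  have hC : ∀ n, MeasurableSet[ℱ n] (C n) := by
    intro n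
    simp only [C, ofPred_forall]
    exact MeasurableSet.iInter fun j => MeasurableSet.iInter fun _ => MeasurableSet.iInter
      fun h => hWm j n h
  have hψm : ∀ n, Measurable fun ω => ENNReal.ofReal (ψ (G n ω)) := fun n =>
    (measurable_from_top (f := fun H => ENNReal.ofReal (ψ H))).comp (hG.measurable n)
  let F : ℕ → Ω → ENNReal := fun n => (C n).indicator fun ω => ENNReal.ofReal (ψ (G n ω))
  have hF : ∀ n, Measurable (F n) := fun n => (hψm n).indicator (ℱ.le n _ (hC n))
  have hFint : ∀ n, ∫⁻ ω, F n ω ∂μ = ∫⁻ ω in C n, ENNReal.ofReal (ψ (G n ω)) ∂μ := fun n =>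
    lintegral_indicator (ℱ.le n _ (hC n)) _
  have hbound : ∀ n, N ≤ n →
      ∫⁻ ω, F n ω ∂μ ≤ ∫⁻ ω in G N ⁻¹' W, ENNReal.ofReal (ψ (G N ω)) ∂μ := by
    intro n hn
    rw [hFint]
    induction n, hn using Nat.le_induction with
    | base => exact lintegral_mono_set fun ω hω => (hmem N ω).1 hω N le_rfl le_rfl
    | succ n hn ih =>
      refine le_trans ?_ ih
      calc _ ≤ ∫⁻ ω in C n, ENNReal.ofReal (ψ (G (n + 1) ω)) ∂μ :=
            lintegral_mono_set fun ω hω =>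
              (hmem n ω).2 fun j h1 h2 => (hmem _ ω).1 hω j h1 (by omega)
        _ = ∫⁻ ω in C n, ENNReal.ofReal (stepMean m p (G n ω) ψ) ∂μ :=
            setLIntegral_succ hG hp n (hC n) hψ
        _ ≤ _ := setLIntegral_mono' (ℱ.le n _ (hC n)) fun ω hω =>
            ENNReal.ofReal_le_ofReal (hW _ ((hmem n ω).1 hω n hn le_rfl))
  have hEF : μ E ≤ μ {ω | c ≤ liminf (fun n => F n ω) atTop} := by
    refine measure_mono_ae ?_
    filter_upwards [hE] with ω hω hωE
    obtain ⟨h1, h2⟩ := hω hωE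
    refine le_of_eq (Tendsto.liminf_eq ?_).symm
    convert h2 using 2 with n
    exact indicator_of_mem ((hmem n ω).2 fun j hj _ => h1 j hj) _
  calc c * μ E ≤ c * μ {ω | c ≤ liminf (fun n => F n ω) atTop} := by gcongr
    _ ≤ ∫⁻ ω, liminf (fun n => F n ω) atTop ∂μ :=
        mul_meas_ge_le_lintegral (Measurable.liminf hF) c
    _ ≤ liminf (fun n => ∫⁻ ω, F n ω ∂μ) atTop := lintegral_liminf_le hF
    _ ≤ _ := liminf_le_of_frequently_le'
        ((eventually_ge_atTop N).mono hbound).frequently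

end IsTypeAdoptionProcess

/-- A bounded sequence that is asymptotically half its running average tends to zero. -/
theorem tendsto_zero_of_sub_half_average {y : ℕ → ℝ} {C : ℝ} (hC : ∀ n, |y n| ≤ C)
    (h : Tendsto (fun n : ℕ => y n - (∑ j ∈ Finset.range n, y j) / (2 * n)) atTop (𝓝 0)) :
    Tendsto y atTop (𝓝 0) := by
  have hstep : ∀ c > 0, (∀ᶠ n in atTop, |y n| ≤ c) → ∀ᶠ n in atTop, |y n| ≤ 3 / 4 * c := by
    intro c hc hev
    obtain ⟨N, hN⟩ := eventually_atTop.1 hev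
    obtain ⟨K, hK⟩ := exists_nat_gt (4 * (N * C) / c)
    have hlim := (Metric.tendsto_nhds.1 h) (c / 8) (by positivity)
    filter_upwards [hlim, eventually_ge_atTop (max N (max K 1))] with n hn hnN
    have hn1 : (1 : ℝ) ≤ n := by exact_mod_cast le_trans (by simp) hnN
    have hnK : (K : ℝ) ≤ n := by exact_mod_cast le_trans (by simp) hnN
    have hnN' : N ≤ n := le_trans (by simp) hnN
    have hsum : |∑ j ∈ Finset.range n, y j| ≤ N * C + n * c := by
      refine (Finset.abs_sum_le_sum_abs _ _).trans ?_
      rw [← Finset.sum_range_add_sum_Ico _ hnN']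
      refine add_le_add ?_ ?_
      · exact (Finset.sum_le_sum fun j _ => hC j).trans (by simp)
      · refine (Finset.sum_le_sum fun j hj => hN j (Finset.mem_Ico.1 hj).1).trans ?_
        simp only [Finset.sum_const, Nat.card_Ico, nsmul_eq_mul]
        gcongr
        exact Nat.sub_le n N
    have hNC : N * C ≤ n * c / 4 := by
      have := (div_lt_iff₀ hc).1 (lt_of_lt_of_le hK hnK)
      linarith
    have hav : |(∑ j ∈ Finset.range n, y j) / (2 * n)| ≤ 5 / 8 * c := by
      rw [abs_div, abs_of_pos (by positivity : (0 : ℝ) < 2 * n), div_le_iff₀ (by positivity)]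
      linarith
    rw [Real.dist_eq, sub_zero] at hn
    calc |y n| = |(y n - (∑ j ∈ Finset.range n, y j) / (2 * n)) +
          (∑ j ∈ Finset.range n, y j) / (2 * n)| := by rw [sub_add_cancel]
      _ ≤ c / 8 + 5 / 8 * c := (abs_add_le _ _).trans (add_le_add hn.le hav)
      _ = 3 / 4 * c := by ring
  have hpow : ∀ k : ℕ, ∀ᶠ n in atTop, |y n| ≤ (3 / 4) ^ k * (|C| + 1) := by
    intro k
    induction k with
    | zero => exact Eventually.of_forall fun n => by linarith [hC n, le_abs_self C]
    | succ k ih =>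
      filter_upwards [hstep _ (by positivity) ih] with n hn
      rw [pow_succ]
      linarith
  rw [Metric.tendsto_nhds]
  intro ε hε
  have hlim : Tendsto (fun k : ℕ => (3 / 4 : ℝ) ^ k * (|C| + 1)) atTop (𝓝 0) := by
    simpa using (tendsto_pow_atTop_nhds_zero_of_lt_one (r := (3 / 4 : ℝ)) (by norm_num)
      (by norm_num)).mul_const (|C| + 1)
  obtain ⟨k, hk⟩ := (hlim.eventually (gt_mem_nhds hε)).exists
  filter_upwards [hpow k] with n hn
  rw [Real.dist_eq, sub_zero]
  exact hn.trans_lt hk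

/-- Kronecker's lemma for the weights `1 / (i + 1)`. -/
theorem tendsto_average_zero_of_tendsto_sum_div {ξ : ℕ → ℝ} {l : ℝ}
    (h : Tendsto (fun n => ∑ i ∈ Finset.range n, ξ i / (i + 1)) atTop (𝓝 l)) :
    Tendsto (fun n : ℕ => (∑ i ∈ Finset.range n, ξ i) / n) atTop (𝓝 0) := by
  have hparts : ∀ n : ℕ, ∑ i ∈ Finset.range n, ξ i =
      n * (∑ i ∈ Finset.range n, ξ i / (i + 1)) -
        ∑ k ∈ Finset.range n, ∑ i ∈ Finset.range k, ξ i / (i + 1) := by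
    intro n
    induction n with
    | zero => simp
    | succ n ih =>
      have : (n : ℝ) + 1 ≠ 0 := by positivity
      rw [Finset.sum_range_succ, ih, Finset.sum_range_succ (fun i => ξ i / ((i : ℝ) + 1)),
        Finset.sum_range_succ (fun k => ∑ i ∈ Finset.range k, ξ i / ((i : ℝ) + 1))]
      push_cast
      field_simp
      ring
  have hlim := h.sub h.cesaro
  rw [sub_self] at hlim
  refine hlim.congr' ?_
  filter_upwards [eventually_ge_atTop 1] with n hn
  have : (n : ℝ) ≠ 0 := by positivity
  rw [hparts n]
  field_simp

section StrongLaw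

variable {Ω : Type*} [mΩ : MeasurableSpace Ω] {μ : Measure Ω} [IsProbabilityMeasure μ]
  {ℱ : Filtration ℕ mΩ}

/-- The strong law of large numbers for bounded martingale differences. -/
theorem ae_tendsto_average_of_condExp_eq_zero {ξ : ℕ → Ω → ℝ} {C : ℝ}
    (hmeas : ∀ n, Measurable[ℱ (n + 1)] (ξ n)) (hC : ∀ n, ∀ᵐ ω ∂μ, |ξ n ω| ≤ C)
    (h0 : ∀ n, μ[ξ n|ℱ n] =ᵐ[μ] 0) :
    ∀ᵐ ω ∂μ, Tendsto (fun n : ℕ => (∑ i ∈ Finset.range n, ξ i ω) / n) atTop (𝓝 0) := by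
  let W : ℕ → Ω → ℝ := fun n ω => ∑ i ∈ Finset.range n, ξ i ω / (i + 1)
  have hξm : ∀ n, Measurable (ξ n) := fun n => (hmeas n).mono (ℱ.le _) le_rfl
  have hξint : ∀ n, Integrable (ξ n) μ := fun n =>
    Integrable.of_bound (hξm n).aestronglyMeasurable C (hC n)
  have hWm : ∀ n, Measurable[ℱ n] (W n) := fun n =>
    Finset.measurable_fun_sum _ fun i hi =>
      (((hmeas i).mono (ℱ.mono (Finset.mem_range.1 hi)) le_rfl).div_const _)
  have hWm' : ∀ n, Measurable (W n) := fun n => (hWm n).mono (ℱ.le n) le_rfl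
  have hWbd : ∀ n, ∀ᵐ ω ∂μ, |W n ω| ≤ n * C := by
    intro n
    filter_upwards [ae_all_iff.2 hC] with ω hω
    refine (Finset.abs_sum_le_sum_abs _ _).trans ((Finset.sum_le_sum
      (g := fun _ => C) fun i _ => ?_).trans (by simp))
    rw [abs_div, abs_of_pos (by positivity : (0 : ℝ) < i + 1)]
    exact (div_le_self (abs_nonneg _) (by linarith [i.cast_nonneg (α := ℝ)])).trans (hω i)
  have hWint : ∀ n, Integrable (W n) μ := fun n =>
    Integrable.of_bound (hWm' n).aestronglyMeasurable _ (hWbd n)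
  have hsucc : ∀ n, W (n + 1) = W n + ((1 : ℝ) / (n + 1)) • ξ n := by
    intro n
    ext ω
    simp only [W, Finset.sum_range_succ, Pi.add_apply, Pi.smul_apply, smul_eq_mul]
    ring
  have hmart : Martingale W ℱ μ := by
    refine martingale_nat (fun n => (hWm n).stronglyMeasurable) hWint fun n => ?_
    rw [hsucc]
    filter_upwards [condExp_add (hWint n) ((hξint n).smul ((1 : ℝ) / (n + 1))) (ℱ n),
      condExp_smul ((1 : ℝ) / (n + 1)) (ξ n) (ℱ n) (μ := μ), h0 n] with ω h1 h2 h3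
    rw [h1, Pi.add_apply, h2, Pi.smul_apply, h3,
      condExp_of_stronglyMeasurable (ℱ.le n) (hWm n).stronglyMeasurable (hWint n)]
    simp
  have hprod : ∀ n, Integrable (W n * ξ n) μ := fun n =>
    (hξint n).bdd_mul (hWm' n).aestronglyMeasurable (hWbd n)
  have horth : ∀ n, ∫ ω, W n ω * ξ n ω ∂μ = 0 := by
    intro n
    have h1 := condExp_mul_of_stronglyMeasurable_left (hWm n).stronglyMeasurable
      (hprod n) (hξint n)
    have h2 : ∫ ω, (μ[W n * ξ n|ℱ n]) ω ∂μ = 0 := by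
      refine integral_eq_zero_of_ae ?_
      filter_upwards [h1, h0 n] with ω h1 h2
      rw [h1, Pi.mul_apply, h2]
      simp
    rwa [integral_condExp (ℱ.le n)] at h2
  have hsq : ∀ n, Integrable (fun ω => W n ω ^ 2) μ := by
    intro n
    refine ((hWint n).bdd_mul (hWm' n).aestronglyMeasurable (hWbd n)).congr
      (ae_of_all _ fun ω => ?_)
    simp [sq]
  have hξsq : ∀ n, Integrable (fun ω => ξ n ω ^ 2) μ := by
    intro n
    refine ((hξint n).bdd_mul (hξm n).aestronglyMeasurable (hC n)).congr
      (ae_of_all _ fun ω => ?_)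
    simp [sq]
  have hsummable : Summable fun i : ℕ => C ^ 2 / ((i : ℝ) + 1) ^ 2 := by
    have h := (summable_nat_add_iff 1).2 (Real.summable_one_div_nat_pow.2 (one_lt_two))
    refine (h.mul_left (C ^ 2)).congr fun i => ?_
    push_cast
    ring
  have hL2 : ∀ n, ∫ ω, W n ω ^ 2 ∂μ ≤ ∑ i ∈ Finset.range n, C ^ 2 / ((i : ℝ) + 1) ^ 2 := by
    intro n
    induction n with
    | zero => simp [W]
    | succ n ih =>
      have hexp : ∀ ω, W (n + 1) ω ^ 2 = W n ω ^ 2 + (2 / ((n : ℝ) + 1)) * (W n ω * ξ n ω) +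
          1 / ((n : ℝ) + 1) ^ 2 * ξ n ω ^ 2 := by
        intro ω
        rw [hsucc]
        simp only [Pi.add_apply, Pi.smul_apply, smul_eq_mul]
        field_simp
        ring
      have h1 : ∫ ω, ξ n ω ^ 2 ∂μ ≤ C ^ 2 := by
        refine (integral_mono_ae (hξsq n) (integrable_const (C ^ 2)) ?_).trans (by simp)
        filter_upwards [hC n] with ω hω
        exact sq_le_sq' (by linarith [neg_abs_le (ξ n ω)]) ((le_abs_self _).trans hω)
      simp only [hexp]
      have hi1 : Integrable (fun ω => 2 / ((n : ℝ) + 1) * (W n ω * ξ n ω)) μ :=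
        (hprod n).const_mul _
      have hi2 : Integrable (fun ω => W n ω ^ 2 + 2 / ((n : ℝ) + 1) * (W n ω * ξ n ω)) μ :=
        (hsq n).add hi1
      rw [integral_add hi2 ((hξsq n).const_mul _), integral_add (hsq n) hi1, integral_const_mul,
        integral_const_mul,
        horth, Finset.sum_range_succ]
      have h2 : 1 / ((n : ℝ) + 1) ^ 2 * ∫ ω, ξ n ω ^ 2 ∂μ ≤ C ^ 2 / ((n : ℝ) + 1) ^ 2 := by
        rw [div_eq_mul_one_div (C ^ 2), mul_comm]
        gcongr
      linarith
  have hL1 : ∀ n, eLpNorm (W n) 1 μ ≤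
      ((1 + ∑' i : ℕ, C ^ 2 / ((i : ℝ) + 1) ^ 2).toNNReal : ENNReal) := by
    intro n
    rw [eLpNorm_one_eq_lintegral_enorm, ← ofReal_integral_norm_eq_lintegral_enorm (hWint n)]
    refine ENNReal.ofReal_le_ofReal ?_
    calc ∫ ω, ‖W n ω‖ ∂μ ≤ ∫ ω, (1 + W n ω ^ 2) ∂μ :=
          integral_mono (hWint n).norm ((integrable_const _).add (hsq n)) fun ω => by
            simp only [Real.norm_eq_abs]
            nlinarith [sq_abs (W n ω), sq_nonneg (|W n ω| - 1)]
      _ = 1 + ∫ ω, W n ω ^ 2 ∂μ := by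
          rw [integral_add (integrable_const _) (hsq n)]
          simp
      _ ≤ _ := by
          gcongr
          exact (hL2 n).trans (hsummable.sum_le_tsum _ fun i _ => by positivity)
  filter_upwards [hmart.submartingale.exists_ae_tendsto_of_bdd hL1] with ω ⟨l, hl⟩
  exact tendsto_average_zero_of_tendsto_sum_div hl

end StrongLaw

namespace IsTypeAdoptionProcess

variable {Ω : Type*} [mΩ : MeasurableSpace Ω] {μ : Measure Ω} [IsProbabilityMeasure μ]
  {ℱ : Filtration ℕ mΩ} {m : ℕ} {p : ℕ → ℝ} {G₀ : ColoredGraph} {G : ℕ → Ω → ColoredGraph}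

/-- The red degree is asymptotically the sum of the contributions of the new nodes and of the
conditional expectations of the numbers of red neighbours. -/
theorem ae_tendsto_redDegree_sub (hG : IsTypeAdoptionProcess μ ℱ m p G₀ G)
    (hp : ∀ k ≤ m, p k ∈ Icc (0 : ℝ) 1) (hS : 0 < G₀.totalDegree) :
    ∀ᵐ ω ∂μ, Tendsto (fun n : ℕ => (((G n ω).redDegree : ℝ) - m * (G n ω).numRed -
      m * ∑ i ∈ Finset.range n, (G i ω).redShare) / n) atTop (𝓝 0) := by
  let q : ColoredGraph → ℝ := fun H => (H.redDegree : ℝ) - m * H.numRed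
  let f : ColoredGraph → ColoredGraph → ℝ := fun H K => |q K - q H|
  have hq : ∀ (H : ColoredGraph) (w : Fin m → Fin H.size) (c : Bool),
      q (H.addNode w c) - q H = H.redNeighbors w := by
    intro H w c
    simp only [q, redDegree_addNode, numRed_addNode]
    cases c
    · simp
    · simp
      ring
  have hf : ∀ (H : ColoredGraph) (w : Fin m → Fin H.size) (c : Bool),
      f H (H.addNode w c) = H.redNeighbors w := by
    intro H w c
    simp only [f, hq, Nat.abs_cast]
  have hf0 : ∀ H K, 0 ≤ f H K := fun H K => abs_nonneg _
  have hpath := ae_path hG hp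
  have hqm : ∀ n, Measurable[ℱ n] fun ω => q (G n ω) := fun n =>
    (measurable_from_top (f := q)).comp (hG.adapted n)
  have hsm : ∀ n, Measurable[ℱ n] fun ω => (m : ℝ) * (G n ω).redShare := fun n =>
    (measurable_from_top (f := fun H : ColoredGraph => (m : ℝ) * H.redShare)).comp (hG.adapted n)
  let ζ : ℕ → Ω → ℝ := fun n ω => f (G n ω) (G (n + 1) ω)
  have hζm : ∀ n, Measurable[ℱ (n + 1)] (ζ n) := fun n =>
    (_root_.continuous_abs.measurable).comp ((hqm (n + 1)).sub
      ((hqm n).mono (ℱ.mono n.le_succ) le_rfl))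
  have hζbd : ∀ n, ∀ᵐ ω ∂μ, 0 ≤ ζ n ω ∧ ζ n ω ≤ m := by
    intro n
    filter_upwards [hpath] with ω hω
    obtain ⟨w, c, h⟩ := hω.2 n
    refine ⟨abs_nonneg _, ?_⟩
    simp only [ζ, h, hf]
    exact_mod_cast redNeighbors_le _ w
  have hζint : ∀ n, Integrable (ζ n) μ := fun n =>
    Integrable.of_bound ((hζm n).mono (ℱ.le _) le_rfl).aestronglyMeasurable m (by
      filter_upwards [hζbd n] with ω hω
      rw [Real.norm_eq_abs, abs_of_nonneg hω.1]
      exact hω.2)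
  have hsint : ∀ n, Integrable (fun ω => (m : ℝ) * (G n ω).redShare) μ := fun n =>
    Integrable.of_bound ((hsm n).mono (ℱ.le _) le_rfl).aestronglyMeasurable m (ae_of_all _ fun ω =>
      by
      rw [Real.norm_eq_abs, abs_of_nonneg (mul_nonneg (by positivity) (redShare_nonneg _))]
      exact mul_le_of_le_one_right (by positivity) (redShare_le_one _))
  have hcond : ∀ n, (fun ω => (m : ℝ) * (G n ω).redShare) =ᵐ[μ] μ[ζ n|ℱ n] := by
    intro n
    refine ae_eq_condExp_of_forall_setIntegral_eq (ℱ.le n) (hζint n)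
      (fun s _ _ => (hsint n).integrableOn) (fun A hA _ => ?_)
      (hsm n).stronglyMeasurable.aestronglyMeasurable
    rw [integral_eq_lintegral_of_nonneg_ae (ae_of_all _ fun ω =>
        mul_nonneg (by positivity) (redShare_nonneg _)) (hsint n).integrableOn.1,
      integral_eq_lintegral_of_nonneg_ae (ae_of_all _ fun ω => hf0 _ _)
        (hζint n).integrableOn.1, show (∫⁻ ω in A, ENNReal.ofReal (ζ n ω) ∂μ) = _ from
        setLIntegral_pair hG hp n hA hf0]
    congr 1
    refine setLIntegral_congr_fun_ae (ℱ.le n _ hA) ?_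
    filter_upwards [ae_totalDegree hG hp] with ω hω _
    have hpos : 0 < (G n ω).totalDegree := by rw [hω]; omega
    rw [stepMean_eq_binomialMean _ hpos m p (fun k _ => (k : ℝ)) (hf _), ← binomialMean_id]
    congr 2
    ext k
    ring
  have hlln := ae_tendsto_average_of_condExp_eq_zero (μ := μ) (ℱ := ℱ) (C := m)
    (ξ := fun n ω => ζ n ω - m * (G n ω).redShare)
    (fun n => (hζm n).sub ((hsm n).mono (ℱ.mono n.le_succ) le_rfl))
    (fun n => by
      filter_upwards [hζbd n] with ω hω
      have h1 := mul_nonneg (Nat.cast_nonneg (α := ℝ) m) (redShare_nonneg (G n ω))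
      have h2 := mul_le_of_le_one_right (Nat.cast_nonneg (α := ℝ) m) (redShare_le_one (G n ω))
      exact abs_le.2 ⟨by linarith [hω.1], by linarith [hω.2]⟩)
    (fun n => by
      filter_upwards [condExp_sub (hζint n) (hsint n) (ℱ n), hcond n] with ω h1 h2
      refine h1.trans ?_
      rw [Pi.sub_apply, ← h2, condExp_of_stronglyMeasurable (ℱ.le n) (hsm n).stronglyMeasurable
        (hsint n), sub_self]
      rfl)
  filter_upwards [hlln, hpath] with ω hω hpω
  have hsum : ∀ n : ℕ, ∑ i ∈ Finset.range n, (ζ i ω - m * (G i ω).redShare) =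
      q (G n ω) - q (G 0 ω) - m * ∑ i ∈ Finset.range n, (G i ω).redShare := by
    intro n
    rw [Finset.sum_sub_distrib, ← Finset.mul_sum, ← Finset.sum_range_sub (fun n => q (G n ω)) n]
    congr 1
    refine Finset.sum_congr rfl fun i _ => ?_
    obtain ⟨w, c, h⟩ := hpω.2 i
    simp only [ζ, h, hf, hq]
  have hconst : Tendsto (fun n : ℕ => q (G 0 ω) / n) atTop (𝓝 0) :=
    tendsto_const_div_atTop_nhds_zero_nat _
  have := hω.add hconst
  rw [add_zero] at this
  refine this.congr fun n => ?_
  rw [hsum]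
  simp only [q]
  ring

/-- If the fraction of red nodes converges, so does the red share of the degrees. -/
theorem ae_tendsto_redShare (hG : IsTypeAdoptionProcess μ ℱ m p G₀ G) (hm : 1 ≤ m)
    (hp : ∀ k ≤ m, p k ∈ Icc (0 : ℝ) 1) (hS : 0 < G₀.totalDegree) {z : ℝ} :
    ∀ᵐ ω ∂μ, Tendsto (fun n => (G n ω).redFraction) atTop (𝓝 z) →
      Tendsto (fun n => (G n ω).redShare) atTop (𝓝 z) := by
  filter_upwards [ae_tendsto_redDegree_sub hG hp hS, ae_path hG hp, ae_totalDegree hG hp]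
    with ω hR hpath hdeg hz
  have hm' : (m : ℝ) ≠ 0 := by positivity
  have hsize : ∀ n, (G n ω).numRed + (G n ω).numBlue = G₀.size + n := by
    intro n
    rw [numRed_add_numBlue]
    induction n with
    | zero => rw [hpath.1, add_zero]
    | succ n ih =>
      obtain ⟨w, c, h⟩ := hpath.2 n
      rw [h, size_addNode, ih, add_assoc]
  have hinv : Tendsto (fun n : ℕ => (n : ℝ)⁻¹) atTop (𝓝 0) := tendsto_inv_atTop_nhds_zero_nat
  have hA : Tendsto (fun n : ℕ => ((G n ω).numRed : ℝ) / n) atTop (𝓝 z) := by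
    have h1 : Tendsto (fun n : ℕ => 1 + (G₀.size : ℝ) * (n : ℝ)⁻¹) atTop (𝓝 1) := by
      simpa using (hinv.const_mul (G₀.size : ℝ)).const_add 1
    have h2 := hz.mul h1
    rw [mul_one] at h2
    refine h2.congr' ?_
    filter_upwards [eventually_ge_atTop 1] with n hn
    have hn' : (n : ℝ) ≠ 0 := by positivity
    have h3 : ((G n ω).numRed : ℝ) + (G n ω).numBlue = G₀.size + n := by exact_mod_cast hsize n
    have h4 : (G₀.size : ℝ) + n ≠ 0 := by positivity
    rw [redFraction, h3]
    field_simp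
    ring
  have hSn : Tendsto (fun n : ℕ => (n : ℝ) / (G n ω).totalDegree) atTop (𝓝 (1 / (2 * m))) := by
    have h1 : Tendsto (fun n : ℕ => 2 * (m : ℝ) + (G₀.totalDegree : ℝ) * (n : ℝ)⁻¹) atTop
        (𝓝 (2 * m)) := by
      simpa using (hinv.const_mul (G₀.totalDegree : ℝ)).const_add (2 * (m : ℝ))
    have h2 := h1.inv₀ (by positivity)
    rw [← one_div] at h2
    refine h2.congr' ?_
    filter_upwards [eventually_ge_atTop 1] with n hn
    have hn' : (n : ℝ) ≠ 0 := by positivity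
    rw [hdeg n]
    push_cast
    have h4 : (G₀.totalDegree : ℝ) + 2 * m * n ≠ 0 := by positivity
    field_simp
    ring
  have hbd : ∀ n, |(G n ω).redShare - z| ≤ 1 + |z| := fun n => by
    refine (abs_sub _ _).trans ?_
    rw [abs_of_nonneg (redShare_nonneg _)]
    gcongr
    exact redShare_le_one _
  have hTbd : ∀ n : ℕ, |(∑ i ∈ Finset.range n, (G i ω).redShare) / n| ≤ 1 := by
    intro n
    rw [abs_of_nonneg (div_nonneg (Finset.sum_nonneg fun i _ => redShare_nonneg _)
      (by positivity))]
    refine div_le_one_of_le₀ ?_ (by positivity)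
    exact (Finset.sum_le_sum fun i _ => redShare_le_one _).trans (by simp)
  have hT : Tendsto (fun n : ℕ => (m * ((n : ℝ) / (G n ω).totalDegree) - 1 / 2) *
      ((∑ i ∈ Finset.range n, (G i ω).redShare) / n)) atTop (𝓝 0) := by
    have h1 : Tendsto (fun n : ℕ => m * ((n : ℝ) / (G n ω).totalDegree) - 1 / 2) atTop (𝓝 0) := by
      have := (hSn.const_mul (m : ℝ)).sub_const (1 / 2)
      convert this using 2
      field_simp
      norm_num
    refine squeeze_zero_norm (fun n => ?_) (tendsto_zero_iff_norm_tendsto_zero.1 h1)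
    rw [norm_mul]
    exact mul_le_of_le_one_right (norm_nonneg _) (hTbd n)
  have hmain : Tendsto (fun n : ℕ => ((G n ω).redShare - z) -
      (∑ j ∈ Finset.range n, ((G j ω).redShare - z)) / (2 * n)) atTop (𝓝 0) := by
    have h1 := (hT.add (hSn.mul ((hA.const_mul (m : ℝ)).add hR))).sub_const (z / 2)
    have h2 : 0 + 1 / (2 * (m : ℝ)) * (m * z + 0) - z / 2 = 0 := by
      field_simp
      ring
    rw [h2] at h1
    refine h1.congr' ?_
    filter_upwards [eventually_ge_atTop 1] with n hn
    have hn' : (n : ℝ) ≠ 0 := by positivity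
    have h4 : ((G n ω).totalDegree : ℝ) ≠ 0 := by
      rw [hdeg n]
      positivity
    rw [redShare, Finset.sum_sub_distrib]
    simp only [Finset.sum_const, Finset.card_range, nsmul_eq_mul]
    field_simp
    ring
  have := (tendsto_zero_of_sub_half_average hbd hmain).add_const z
  simpa using this

end IsTypeAdoptionProcess

namespace IsTypeAdoptionProcess

variable {Ω : Type*} [mΩ : MeasurableSpace Ω] {μ : Measure Ω} [IsProbabilityMeasure μ]
  {ℱ : Filtration ℕ mΩ} {m : ℕ} {p : ℕ → ℝ} {G₀ : ColoredGraph} {G : ℕ → Ω → ColoredGraph}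

/-- If `ψ` decreases on average in the window `W`, then almost surely the process does not stay in
`W` with `ψ` tending to infinity. -/
theorem ae_not_tendsto_atTop (hG : IsTypeAdoptionProcess μ ℱ m p G₀ G)
    (hp : ∀ k ≤ m, p k ∈ Icc (0 : ℝ) 1) {ψ : ColoredGraph → ℝ} (hψ : ∀ H, 0 ≤ ψ H)
    {W : Set ColoredGraph} (hW : ∀ H ∈ W, stepMean m p H ψ ≤ ψ H)
    (hB : ∀ s, ∃ B, ∀ H ∈ W, H.totalDegree = s → ψ H ≤ B) :
    ∀ᵐ ω ∂μ, ∀ N, (∀ n, N ≤ n → G n ω ∈ W) → ¬Tendsto (fun n => ψ (G n ω)) atTop atTop := by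
  refine ae_all_iff.2 fun N => ?_
  obtain ⟨B, hB⟩ := hB (G₀.totalDegree + 2 * m * N)
  let E : Set Ω := {ω | (∀ n, N ≤ n → G n ω ∈ W) ∧ Tendsto (fun n => ψ (G n ω)) atTop atTop}
  have hE : ∀ ω, ω ∈ E ↔ (∀ n, N ≤ n → G n ω ∈ W) ∧
    Tendsto (fun n => ψ (G n ω)) atTop atTop := fun ω => Iff.rfl
  have h1 := mul_measure_le_of_stepMean_le hG hp hψ hW N (E := E) (c := ⊤)
    (ae_of_all _ fun ω hω => ⟨((hE ω).1 hω).1, ENNReal.tendsto_ofReal_atTop.comp ((hE ω).1 hω).2⟩)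
  have h2 : ∫⁻ ω in G N ⁻¹' W, ENNReal.ofReal (ψ (G N ω)) ∂μ ≤ ENNReal.ofReal B := by
    calc _ ≤ ∫⁻ _ω in G N ⁻¹' W, ENNReal.ofReal B ∂μ := by
          refine setLIntegral_mono_ae' (hG.measurable N trivial) ?_
          filter_upwards [ae_totalDegree hG hp] with ω hω hωW
          exact ENNReal.ofReal_le_ofReal (hB _ hωW (hω N))
      _ ≤ ENNReal.ofReal B * 1 := by
          rw [setLIntegral_const]
          gcongr
          exact prob_le_one
      _ = _ := mul_one _
  have h3 : μ E = 0 := by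
    by_contra hne
    rw [ENNReal.top_mul hne] at h1
    exact absurd (h1.trans h2) (by simp)
  filter_upwards [measure_eq_zero_iff_ae_notMem.1 h3] with ω hω h4 h5
  exact hω ((hE ω).2 ⟨h4, h5⟩)

theorem ae_tendsto_totalDegree (hG : IsTypeAdoptionProcess μ ℱ m p G₀ G) (hm : 1 ≤ m)
    (hp : ∀ k ≤ m, p k ∈ Icc (0 : ℝ) 1) :
    ∀ᵐ ω ∂μ, Tendsto (fun n => ((G n ω).totalDegree : ℝ)) atTop atTop := by
  filter_upwards [ae_totalDegree hG hp] with ω hω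
  refine tendsto_atTop_mono (fun n => ?_) tendsto_natCast_atTop_atTop
  rw [hω n]
  exact_mod_cast (by nlinarith : n ≤ G₀.totalDegree + 2 * m * n)

/-- A positive degree sum `V` that moves with probability at least its share in the sum of
all degrees moves infinitely often. -/
theorem ae_not_eventually_const (hG : IsTypeAdoptionProcess μ ℱ m p G₀ G) (hm : 1 ≤ m)
    (hp : ∀ k ≤ m, p k ∈ Icc (0 : ℝ) 1) {V : ColoredGraph → ℕ}
    (hstay : ∀ H : ColoredGraph, 0 < H.totalDegree →
      stepMean m p H (fun K => if V K = V H then 1 else 0) ≤ 1 - (V H : ℝ) / H.totalDegree)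
    (hS : 0 < G₀.totalDegree) :
    ∀ᵐ ω ∂μ, ∀ k, 0 < k → ∀ N, ¬∀ n, N ≤ n → V (G n ω) = k := by
  have hm1 : (1 : ℝ) ≤ m := by exact_mod_cast hm
  refine ae_all_iff.2 fun k => ?_
  by_cases hk : 0 < k
  swap
  · exact ae_of_all _ fun _ h => absurd h hk
  set β : ℝ := 1 / (2 * m) with hβ
  have hβ0 : 0 < β := by positivity
  have hβ1 : β ≤ 1 := by
    rw [hβ, div_le_one (by positivity)]
    linarith
  let ψ : ColoredGraph → ℝ := fun H => (H.totalDegree : ℝ) ^ β * if V H = k then 1 else 0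
  have hψ : ∀ H, 0 ≤ ψ H := fun H => by
    simp only [ψ]
    positivity
  let W : Set ColoredGraph := {H | V H = k ∧ 0 < H.totalDegree}
  have hWmem : ∀ H, H ∈ W ↔ V H = k ∧ 0 < H.totalDegree := fun H => Iff.rfl
  have hW : ∀ H ∈ W, stepMean m p H ψ ≤ ψ H := by
    intro H hH
    obtain ⟨h1, h2⟩ := (hWmem H).1 hH
    have hS : (0 : ℝ) < H.totalDegree := by positivity
    have h3 : stepMean m p H ψ ≤ stepMean m p H fun K =>
        ((H.totalDegree : ℝ) + 2 * m) ^ β * if V K = V H then 1 else 0 := by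
      refine stepMean_mono hp H fun w c => ?_
      simp only [ψ, totalDegree_addNode, h1]
      push_cast
      exact le_rfl
    rw [stepMean_const_mul] at h3
    have h4 : ψ H = (H.totalDegree : ℝ) ^ β := by simp [ψ, h1]
    have h5 : ((H.totalDegree : ℝ) + 2 * m) ^ β ≤
        (H.totalDegree : ℝ) ^ β * (1 + 1 / H.totalDegree) := by
      have h6 : (H.totalDegree : ℝ) + 2 * m = H.totalDegree * (1 + 2 * m / H.totalDegree) := by
        field_simp
      rw [h6, Real.mul_rpow hS.le (by positivity)]
      gcongr
      refine (rpow_one_add_le_one_add_mul_self (le_trans (by norm_num)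
        (by positivity : (0 : ℝ) ≤ 2 * m / H.totalDegree)) hβ0.le hβ1).trans (le_of_eq ?_)
      rw [hβ]
      field_simp
    have h7 : stepMean m p H (fun K => if V K = V H then 1 else 0) ≤ 1 - 1 / H.totalDegree := by
      refine (hstay H h2).trans ?_
      gcongr
      rw [h1]
      exact_mod_cast hk
    have h8 : (1 : ℝ) / H.totalDegree ≤ 1 := by
      rw [div_le_one hS]
      exact_mod_cast h2
    rw [h4]
    calc _ ≤ _ := h3
      _ ≤ ((H.totalDegree : ℝ) ^ β * (1 + 1 / H.totalDegree)) * (1 - 1 / H.totalDegree) :=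
          mul_le_mul h5 h7 (stepMean_nonneg hp H fun w c => by split_ifs <;> simp) (by positivity)
      _ = (H.totalDegree : ℝ) ^ β * (1 - (1 / H.totalDegree) ^ 2) := by ring
      _ ≤ _ := mul_le_of_le_one_right (by positivity)
          (by linarith [sq_nonneg (1 / (H.totalDegree : ℝ))])
  filter_upwards [ae_not_tendsto_atTop hG hp hψ hW fun s => ⟨(s : ℝ) ^ β, fun H hH hs => by
    simp [ψ, ((hWmem H).1 hH).1, hs]⟩, ae_tendsto_totalDegree hG hm hp, ae_totalDegree hG hp]
    with ω h1 h2 h3 _ N h4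
  refine h1 N (fun n hn => (hWmem _).2 ⟨h4 n hn, by rw [h3]; omega⟩) ?_
  refine ((tendsto_rpow_atTop hβ0).comp h2).congr' ?_
  filter_upwards [eventually_ge_atTop N] with n hn
  simp [ψ, h4 n hn]

/-- If the drift near zero of the share of `V` in the sum of all degrees is at least that of the
Pólya urn, then the share does not tend to zero. -/
theorem ae_not_tendsto_share_zero (hG : IsTypeAdoptionProcess μ ℱ m p G₀ G) (hm : 1 ≤ m)
    (hp : ∀ k ≤ m, p k ∈ Icc (0 : ℝ) 1) {V : ColoredGraph → ℕ} {ε : ℝ} (hε : 0 < ε)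
    (hV : ∀ (H : ColoredGraph) (w : Fin m → Fin H.size) c,
      V H ≤ V (H.addNode w c) ∧ V (H.addNode w c) ≤ V H + 2 * m)
    (hstay : ∀ H : ColoredGraph, 0 < H.totalDegree →
      stepMean m p H (fun K => if V K = V H then 1 else 0) ≤ 1 - (V H : ℝ) / H.totalDegree)
    (hdrift : ∀ H : ColoredGraph, 0 < H.totalDegree → 0 < V H → (V H : ℝ) / H.totalDegree < ε →
      V H + 2 * m * ((V H : ℝ) / H.totalDegree) ≤ stepMean m p H fun K => (V K : ℝ))
    (hS : 0 < G₀.totalDegree) (hV₀ : 0 < V G₀) :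
    ∀ᵐ ω ∂μ, ¬Tendsto (fun n => (V (G n ω) : ℝ) / (G n ω).totalDegree) atTop (𝓝 0) := by
  let ψ : ColoredGraph → ℝ := fun H => if 2 * m < V H then
    (H.totalDegree : ℝ) / ((V H : ℝ) - 2 * m) else 0
  have hcast : ∀ H, 2 * m < V H → (1 : ℝ) ≤ (V H : ℝ) - 2 * m := by
    intro H h
    have : ((2 * m + 1 : ℕ) : ℝ) ≤ V H := by exact_mod_cast h
    push_cast at this
    linarith
  have hψ : ∀ H, 0 ≤ ψ H := by
    intro H
    simp only [ψ]
    split_ifs with h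
    · exact div_nonneg (by positivity) (by linarith [hcast H h])
    · exact le_rfl
  let W : Set ColoredGraph :=
    {H | 2 * m < V H ∧ (V H : ℝ) / H.totalDegree < ε ∧ 0 < H.totalDegree}
  have hWmem : ∀ H, H ∈ W ↔ 2 * m < V H ∧ (V H : ℝ) / H.totalDegree < ε ∧ 0 < H.totalDegree :=
    fun H => Iff.rfl
  have hW : ∀ H ∈ W, stepMean m p H ψ ≤ ψ H := by
    intro H hH
    obtain ⟨h1, h2, h3⟩ := (hWmem H).1 hH
    obtain ⟨Z, hZ⟩ : ∃ Z : ℝ, Z = (V H : ℝ) - 2 * m := ⟨_, rfl⟩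
    have hZ1 : 1 ≤ Z := hZ ▸ hcast H h1
    have hVZ : (V H : ℝ) = Z + 2 * m := by linarith
    have hS : (0 : ℝ) < H.totalDegree := by positivity
    obtain ⟨S, hSdef⟩ : ∃ S : ℝ, S = H.totalDegree := ⟨_, rfl⟩
    rw [← hSdef] at hS
    have hm0 : (0 : ℝ) ≤ m := by positivity
    have hle : stepMean m p H ψ ≤ stepMean m p H fun K =>
        2 * (S + 2 * m) / Z + (-((S + 2 * m) / (Z * (Z + 2 * m)))) * V K := by
      refine stepMean_mono hp H fun w c => ?_
      obtain ⟨h4, h5⟩ := hV H w c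
      obtain ⟨D, hD⟩ : ∃ D : ℝ, D = (V (H.addNode w c) : ℝ) - V H := ⟨_, rfl⟩
      have hD0 : 0 ≤ D := by
        have : (V H : ℝ) ≤ V (H.addNode w c) := by exact_mod_cast h4
        linarith
      have hD1 : D ≤ 2 * m := by
        have : (V (H.addNode w c) : ℝ) ≤ V H + 2 * m := by exact_mod_cast h5
        linarith
      have hVK : (V (H.addNode w c) : ℝ) = Z + 2 * m + D := by linarith
      simp only [ψ]
      rw [if_pos (lt_of_lt_of_le h1 h4), totalDegree_addNode, hVK]
      push_cast
      rw [← hSdef]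
      have e1 : Z + 2 * m + D - 2 * m = Z + D := by ring
      have e2 : 2 * (S + 2 * m) / Z + (-((S + 2 * m) / (Z * (Z + 2 * m)))) * (Z + 2 * m + D) =
          (S + 2 * m) * ((Z + 2 * m - D) / (Z * (Z + 2 * m))) := by
        field_simp
        ring
      rw [e1, e2, div_eq_mul_one_div]
      refine mul_le_mul_of_nonneg_left ?_ (by linarith)
      rw [div_le_div_iff₀ (by linarith) (by positivity)]
      nlinarith
    refine hle.trans ?_
    rw [stepMean_add, stepMean_const p h3, stepMean_const_mul]
    have hmean := hdrift H h3 (by omega) h2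
    rw [← hSdef, hVZ] at hmean
    have hψH : ψ H = S / Z := by
      simp only [ψ]
      rw [if_pos h1, hZ, hSdef]
    rw [hψH]
    have hcoef : 0 ≤ (S + 2 * m) / (Z * (Z + 2 * m)) := by positivity
    calc _ ≤ 2 * (S + 2 * m) / Z - (S + 2 * m) / (Z * (Z + 2 * m)) *
          (Z + 2 * m + 2 * m * ((Z + 2 * m) / S)) := by
          have := mul_le_mul_of_nonneg_left hmean hcoef
          linarith
      _ = S / Z - (2 * m) ^ 2 / (S * Z) := by
          field_simp
          ring
      _ ≤ S / Z := by
          have : 0 ≤ (2 * (m : ℝ)) ^ 2 / (S * Z) := by positivity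
          linarith
  have hB : ∀ s : ℕ, ∃ B : ℝ, ∀ H ∈ W, H.totalDegree = s → ψ H ≤ B := by
    refine fun s => ⟨s, fun H hH hs => ?_⟩
    have h1 := ((hWmem H).1 hH).1
    simp only [ψ]
    rw [if_pos h1, hs]
    exact div_le_self (by positivity) (hcast H h1)
  filter_upwards [ae_not_tendsto_atTop hG hp hψ hW hB, ae_not_eventually_const hG hm hp hstay hS,
    ae_path hG hp, ae_totalDegree hG hp] with ω h1 h2 hpath hdeg hlim
  have hdeg0 : ∀ n, 0 < (G n ω).totalDegree := fun n => by rw [hdeg]; omega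
  have hmono : Monotone fun n => V (G n ω) := monotone_nat_of_le_succ fun n => by
    obtain ⟨w, c, h⟩ := hpath.2 n
    rw [h]
    exact (hV _ w c).1
  have hpos : ∀ n, 0 < V (G n ω) := fun n => by
    refine lt_of_lt_of_le hV₀ ?_
    have := hmono n.zero_le
    simpa only [hpath.1] using this
  by_cases hbig : ∃ N, 2 * m < V (G N ω)
  · obtain ⟨N, hN⟩ := hbig
    obtain ⟨N', hN'⟩ := eventually_atTop.1 (hlim.eventually (gt_mem_nhds hε))
    refine h1 (max N N') (fun n hn => (hWmem _).2 ⟨lt_of_lt_of_le hN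
      (hmono (le_trans (le_max_left _ _) hn)), hN' n (le_trans (le_max_right _ _) hn),
      hdeg0 n⟩) ?_
    have hinv : Tendsto (fun n => ((V (G n ω) : ℝ) / (G n ω).totalDegree)⁻¹) atTop atTop := by
      refine Tendsto.inv_tendsto_nhdsGT_zero ?_
      refine tendsto_nhdsWithin_iff.2 ⟨hlim, Eventually.of_forall fun n => ?_⟩
      have h3 : (0 : ℝ) < V (G n ω) := by exact_mod_cast hpos n
      have h4 : (0 : ℝ) < (G n ω).totalDegree := by exact_mod_cast hdeg0 n
      exact div_pos h3 h4
    refine tendsto_atTop_mono' _ ?_ hinv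
    filter_upwards [eventually_ge_atTop N] with n hn
    have h3 : 2 * m < V (G n ω) := lt_of_lt_of_le hN (hmono hn)
    simp only [ψ]
    rw [if_pos h3, inv_div]
    have h4 := hcast _ h3
    gcongr
    linarith [(Nat.cast_nonneg m : (0 : ℝ) ≤ m)]
  · push Not at hbig
    obtain ⟨k, ⟨N, rfl⟩, hk⟩ := Set.exists_max_image (range fun n => V (G n ω)) id
      ((Set.finite_Iic (2 * m)).subset (by rintro _ ⟨n, rfl⟩; exact hbig n)) (range_nonempty _)
    exact h2 _ (hpos N) N fun n hn => le_antisymm (hk _ ⟨n, rfl⟩) (hmono hn)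

theorem ae_not_tendsto_redShare_zero (hG : IsTypeAdoptionProcess μ ℱ m p G₀ G) (hm : 1 ≤ m)
    (hp : ∀ k ≤ m, p k ∈ Icc (0 : ℝ) 1) (hX₀ : 0 < G₀.redDegree) {ε : ℝ} (hε : 0 < ε)
    (hpos : ∀ x ∈ Ioo (0 : ℝ) ε, 0 < driftPoly m p x) :
    ∀ᵐ ω ∂μ, ¬Tendsto (fun n => (G n ω).redShare) atTop (𝓝 0) := by
  have hm0 : (0 : ℝ) < m := by positivity
  refine ae_not_tendsto_share_zero hG hm hp hε (V := redDegree) (fun H w c => ?_)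
    (fun H hS => ?_) (fun H hS hV hlt => ?_) (by unfold totalDegree; omega) hX₀
  · have := redNeighbors_le H w
    rw [redDegree_addNode]
    split_ifs <;> omega
  · rw [stepMean_eq_binomialMean H hS m p
      (fun k c => if k + (if c then m else 0) = 0 then 1 else 0) fun w c => by
        rw [redDegree_addNode]
        exact if_congr (by omega) rfl rfl]
    refine (binomialMean_mono (redShare_nonneg H) (redShare_le_one H)
      (g := fun k => 1 + (-1 / (m : ℝ)) * k) fun k hk => ?_).trans (le_of_eq ?_)
    · have hpk := hp k hk
      rcases Nat.eq_zero_or_pos k with rfl | hk0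
      · simp [hpk.1, show m ≠ 0 by omega]
      · have : (k : ℝ) / m ≤ 1 := div_le_one_of_le₀ (by exact_mod_cast hk) hm0.le
        simp only [show ∀ j, k + j ≠ 0 by omega, if_false]
        linarith [show -1 / (m : ℝ) * k = -(k / m) by ring]
    · rw [binomialMean_add, binomialMean_const, binomialMean_const_mul, binomialMean_id,
        redShare]
      field_simp
      ring
  · rw [stepMean_redDegree hm p hS]
    have hlt' : H.redShare < ε := hlt
    have hpos' := hpos H.redShare ⟨div_pos (by exact_mod_cast hV) (by exact_mod_cast hS), hlt'⟩
    have : 0 ≤ 2 * m * driftPoly m p H.redShare := by positivity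
    change _ + 2 * (m : ℝ) * H.redShare ≤ _
    linarith

theorem ae_not_tendsto_redShare_one (hG : IsTypeAdoptionProcess μ ℱ m p G₀ G) (hm : 1 ≤ m)
    (hp : ∀ k ≤ m, p k ∈ Icc (0 : ℝ) 1) (hY₀ : 0 < G₀.blueDegree) {ε : ℝ} (hε : 0 < ε)
    (hneg : ∀ x ∈ Ioo (1 - ε) (1 : ℝ), driftPoly m p x < 0) :
    ∀ᵐ ω ∂μ, ¬Tendsto (fun n => (G n ω).redShare) atTop (𝓝 1) := by
  have hm0 : (0 : ℝ) < m := by positivity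
  have hS₀ : 0 < G₀.totalDegree := by unfold totalDegree; omega
  have hshare : ∀ H : ColoredGraph, 0 < H.totalDegree →
      (H.blueDegree : ℝ) / H.totalDegree = 1 - H.redShare := by
    intro H hS
    have h1 : (H.totalDegree : ℝ) = H.redDegree + H.blueDegree := by
      unfold totalDegree
      push_cast
      rfl
    have h2 : (H.totalDegree : ℝ) ≠ 0 := by positivity
    rw [redShare]
    field_simp
    rw [h1]
    ring
  have key := ae_not_tendsto_share_zero hG hm hp hε (V := blueDegree) (fun H w c => ?_)
    (fun H hS => ?_) (fun H hS hV hlt => ?_) hS₀ hY₀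
  · filter_upwards [key, ae_totalDegree hG hp] with ω h1 h2 h3
    refine h1 ?_
    have h4 := h3.const_sub 1
    rw [sub_self] at h4
    exact h4.congr fun n => (hshare _ (by rw [h2]; omega)).symm
  · have h1 := redNeighbors_le H w
    have h2 := blueDegree_addNode H w c
    split_ifs at h2 <;> omega
  · rw [stepMean_eq_binomialMean H hS m p
      (fun k c => if k = m + (if c then 0 else m) then 1 else 0) fun w c => by
        have := blueDegree_addNode H w c
        exact if_congr (by omega) rfl rfl, hshare H hS]
    refine (binomialMean_mono (redShare_nonneg H) (redShare_le_one H)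
      (g := fun k => (1 / (m : ℝ)) * k) fun k hk => ?_).trans (le_of_eq ?_)
    · have hpk := hp k hk
      rcases hk.eq_or_lt with rfl | hk0
      · have : (1 / (k : ℝ)) * k = 1 := by field_simp
        rw [this]
        simp [hpk.2, show k ≠ 0 by omega]
      · simp only [show ∀ j, k ≠ m + j by omega, if_false]
        have : 0 ≤ (1 / (m : ℝ)) * k := by positivity
        linarith
    · rw [binomialMean_const_mul, binomialMean_id]
      field_simp
      ring
  · have hblue : (fun K : ColoredGraph => (K.blueDegree : ℝ)) =
        fun K => (K.totalDegree : ℝ) + (-1) * K.redDegree := by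
      ext K
      unfold totalDegree
      push_cast
      ring
    have htotal : stepMean m p H (fun K => (K.totalDegree : ℝ)) = H.totalDegree + 2 * m := by
      rw [stepMean_eq_binomialMean H hS m p (fun _ _ => (H.totalDegree : ℝ) + 2 * m)
        fun w c => by rw [totalDegree_addNode]; push_cast; rfl]
      convert binomialMean_const m H.redShare (H.totalDegree + 2 * m) using 2
      ext k
      ring
    have hB : (H.blueDegree : ℝ) = H.totalDegree + (-1) * H.redDegree := congrFun hblue H
    rw [hblue, stepMean_add, htotal, stepMean_const_mul, stepMean_redDegree hm p hS]
    have hS' : (0 : ℝ) < H.totalDegree := by exact_mod_cast hS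
    have hV' : 0 < (H.blueDegree : ℝ) / H.totalDegree := div_pos (by exact_mod_cast hV) hS'
    rw [hshare H hS] at hlt hV' ⊢
    have hneg' := hneg H.redShare ⟨by linarith, by linarith⟩
    have : 0 ≤ 2 * m * (-driftPoly m p H.redShare) :=
      mul_nonneg (by positivity) (by linarith)
    linarith

end IsTypeAdoptionProcess

theorem exp_neg_le_one_sub_add_sq {θ : ℝ} (h : |θ| ≤ 1) : Real.exp (-θ) ≤ 1 - θ + θ ^ 2 := by
  have := (abs_le.1 (Real.abs_exp_sub_one_sub_id_le (x := -θ) (by rwa [abs_neg]))).2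
  linarith [neg_sq θ]

/-- The effect of a jump of size `d / S` on a Gaussian kernel of variance `8 * m * r`. -/
theorem exp_gaussian_jump_le {m S r u d : ℝ} (hm : 1 ≤ m) (hS : m ≤ S) (hr : 1 / S ≤ r)
    (hu : |u| ≤ 1) (hd : |d| ≤ 2 * m) :
    Real.exp (-((u + d / S) ^ 2 / (16 * m * r))) ≤ Real.exp (-(u ^ 2 / (16 * m * r))) *
      (1 - (2 * u * (d / S) + (d / S) ^ 2) / (16 * m * r) +
        (u ^ 2 / (8 * S ^ 2 * r ^ 2) + m ^ 2 / (8 * S ^ 4 * r ^ 2))) := by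
  have hS0 : 0 < S := by linarith
  have hr0 : 0 < r := lt_of_lt_of_le (by positivity) hr
  have hSr : 1 ≤ S * r := by rw [div_le_iff₀ hS0] at hr; linarith
  obtain ⟨e, he⟩ : ∃ e, e = d / S := ⟨_, rfl⟩
  have heS : |e| * S ≤ 2 * m := by
    rw [he, abs_div, abs_of_pos hS0, div_mul_cancel₀ _ hS0.ne']
    exact hd
  have he2 : e ^ 2 ≤ 4 * m ^ 2 / S ^ 2 := by
    rw [le_div_iff₀ (by positivity), ← sq_abs e, ← mul_pow]
    calc (|e| * S) ^ 2 ≤ (2 * m) ^ 2 := by gcongr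
      _ = _ := by ring
  rw [← he]
  have hsplit : -((u + e) ^ 2 / (16 * m * r)) =
      -(u ^ 2 / (16 * m * r)) + -((2 * u * e + e ^ 2) / (16 * m * r)) := by ring
  rw [hsplit, Real.exp_add]
  refine mul_le_mul_of_nonneg_left ?_ (Real.exp_pos _).le
  have hθ : |(2 * u * e + e ^ 2) / (16 * m * r)| ≤ 1 := by
    rw [abs_div, abs_of_pos (by positivity : 0 < 16 * m * r), div_le_one (by positivity)]
    have h1 : |2 * u * e + e ^ 2| ≤ 2 * |e| + |e| * |e| := by
      refine (abs_add_le _ _).trans ?_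
      rw [abs_mul, abs_mul, abs_two, abs_pow, sq]
      gcongr
      nlinarith [abs_nonneg u]
    have h2 : |e| ≤ 2 := by nlinarith [abs_nonneg e]
    have h3 : |e| ≤ 2 * m * r := by nlinarith [abs_nonneg e]
    nlinarith [abs_nonneg e]
  refine (exp_neg_le_one_sub_add_sq hθ).trans ?_
  have hsq : ((2 * u * e + e ^ 2) / (16 * m * r)) ^ 2 ≤
      u ^ 2 / (8 * S ^ 2 * r ^ 2) + m ^ 2 / (8 * S ^ 4 * r ^ 2) := by
    have h1 : (2 * u * e + e ^ 2) ^ 2 ≤ 8 * u ^ 2 * e ^ 2 + 2 * (e ^ 2) ^ 2 := by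
      nlinarith [sq_nonneg (2 * u * e - e ^ 2)]
    calc _ = (2 * u * e + e ^ 2) ^ 2 / (256 * m ^ 2 * r ^ 2) := by rw [div_pow]; ring
      _ ≤ (8 * u ^ 2 * (4 * m ^ 2 / S ^ 2) + 2 * (4 * m ^ 2 / S ^ 2) ^ 2) /
          (256 * m ^ 2 * r ^ 2) := by
          gcongr
          exact h1.trans (by gcongr)
      _ = _ := by
          field_simp
          ring
  linarith

/-- The exponents in the one step estimate for the Gaussian kernel add up to something negative. -/
theorem gaussian_exponent_le {m S η u v : ℝ} (hm : 1 ≤ m) (hS : 2 * m ≤ S) (hη : 0 < η)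
    (hv : 0 < v) (hSv : 4 * m ^ 3 ≤ v * S) :
    -(v / (128 * m ^ 2) * Real.log (1 / (S + 2 * m) + η)) -
        u ^ 2 / (16 * m * (1 / (S + 2 * m) + η)) +
      (u ^ 2 / (8 * (S + 2 * m) ^ 2 * (1 / (S + 2 * m) + η) ^ 2) +
        m ^ 2 / (8 * (S + 2 * m) ^ 4 * (1 / (S + 2 * m) + η) ^ 2) -
        v / (16 * m * (1 / (S + 2 * m) + η) * (S + 2 * m) ^ 2)) ≤
      -(v / (128 * m ^ 2) * Real.log (1 / S + η)) - u ^ 2 / (16 * m * (1 / S + η)) := by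
  have hS0 : 0 < S := by linarith
  obtain ⟨T, hT⟩ : ∃ T, T = S + 2 * m := ⟨_, rfl⟩
  obtain ⟨r, hr⟩ : ∃ r, r = 1 / S + η := ⟨_, rfl⟩
  obtain ⟨q, hq⟩ : ∃ q, q = 1 / T + η := ⟨_, rfl⟩
  rw [← hT, ← hr, ← hq]
  have hT0 : 0 < T := by linarith
  have hr0 : 0 < r := by rw [hr]; positivity
  have hq0 : 0 < q := by rw [hq]; positivity
  have hrq : r - q = 2 * m / (S * T) := by
    rw [hr, hq]
    field_simp
    rw [hT]
    ring
  have hqT : 1 ≤ q * T := by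
    rw [hq, add_mul, one_div, inv_mul_cancel₀ hT0.ne']
    linarith [mul_pos hη hT0]
  have hrS : r * S ≤ q * T := by
    rw [hr, hq, add_mul, add_mul, one_div, one_div, inv_mul_cancel₀ hT0.ne',
      inv_mul_cancel₀ hS0.ne']
    nlinarith
  have hlog : Real.log r - Real.log q ≤ 2 * m / (S * T) / q := by
    rw [← Real.log_div hr0.ne' hq0.ne']
    refine (Real.log_le_sub_one_of_pos (by positivity)).trans (le_of_eq ?_)
    rw [← hrq]
    field_simp
  have hu : u ^ 2 / (8 * T ^ 2 * q ^ 2) ≤ u ^ 2 / (16 * m * q) - u ^ 2 / (16 * m * r) := by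
    have h1 : u ^ 2 / (16 * m * q) - u ^ 2 / (16 * m * r) = u ^ 2 / (8 * (q * T) * (r * S)) := by
      have : u ^ 2 / (16 * m * q) - u ^ 2 / (16 * m * r) =
          u ^ 2 * (r - q) / (16 * m * q * r) := by
        field_simp
      rw [this, hrq]
      field_simp
      ring
    rw [h1]
    refine div_le_div_of_nonneg_left (sq_nonneg u) (by positivity) ?_
    have : 0 < q * T := by positivity
    nlinarith
  have hconst : v / (128 * m ^ 2) * (2 * m / (S * T) / q) + m ^ 2 / (8 * T ^ 4 * q ^ 2) ≤
      v / (16 * m * q * T ^ 2) := by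
    have h1 : v / (128 * m ^ 2) * (2 * m / (S * T) / q) ≤ v / (32 * m * q * T ^ 2) := by
      have : v / (128 * m ^ 2) * (2 * m / (S * T) / q) = v / (64 * m * q * T * S) := by
        field_simp
        ring
      rw [this]
      refine div_le_div_of_nonneg_left hv.le (by positivity) ?_
      have h2 : T ≤ 2 * S := by linarith
      have h3 : 0 ≤ 32 * m * q * T := by positivity
      nlinarith
    have h4 : m ^ 2 / (8 * T ^ 4 * q ^ 2) ≤ v / (32 * m * q * T ^ 2) := by
      rw [div_le_div_iff₀ (by positivity) (by positivity)]
      have h5 : 4 * m ^ 3 ≤ v * T * (q * T) := by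
        have : v * S ≤ v * T := mul_le_mul_of_nonneg_left (by linarith) hv.le
        have : 0 < v * T := by positivity
        nlinarith
      have h6 : 0 ≤ 8 * q * T ^ 2 := by positivity
      nlinarith [mul_le_mul_of_nonneg_left h5 h6]
    have h7 : v / (16 * m * q * T ^ 2) = v / (32 * m * q * T ^ 2) + v / (32 * m * q * T ^ 2) := by
      field_simp
      norm_num
    linarith
  have hα : 0 ≤ v / (128 * m ^ 2) := by positivity
  nlinarith [mul_le_mul_of_nonneg_left hlog hα]

namespace ColoredGraph

/-- For `2 ≤ m` the increment of the red degree has a nondegenerate conditional distribution. -/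
theorem le_stepMean_sq {m : ℕ} (hm : 2 ≤ m) {p : ℕ → ℝ} (hp : ∀ k ≤ m, p k ∈ Icc (0 : ℝ) 1)
    {H : ColoredGraph} (hS : 0 < H.totalDegree) {a : ℝ} (ha : 0 ≤ a) (ha1 : a ≤ H.redShare)
    (ha2 : a ≤ 1 - H.redShare) (t : ℝ) :
    a ^ m / 2 ≤ stepMean m p H fun K => ((K.redDegree : ℝ) - H.redDegree - t) ^ 2 := by
  rw [stepMean_eq_binomialMean H hS m p
    (fun k c => ((k : ℝ) + (if c then (m : ℝ) else 0) - t) ^ 2) fun w c => by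
      rw [redDegree_addNode]
      push_cast
      ring]
  obtain ⟨g, hg⟩ : ∃ g : ℕ → ℝ, g = fun k => p k * ((k : ℝ) + m - t) ^ 2 +
    (1 - p k) * ((k : ℝ) - t) ^ 2 := ⟨_, rfl⟩
  have hgeq : (fun k : ℕ => p k * ((k : ℝ) + (if true = true then (m : ℝ) else 0) - t) ^ 2 +
      (1 - p k) * ((k : ℝ) + (if false = true then (m : ℝ) else 0) - t) ^ 2) = g := by
    rw [hg]
    ext k
    simp
  rw [hgeq]
  have hx := redShare_nonneg H
  have hx1 : 0 ≤ 1 - H.redShare := by linarith [redShare_le_one H]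
  have hg0 : ∀ k ≤ m, 0 ≤ g k := fun k hk => by
    have h1 := (hp k hk).1
    have h2 : 0 ≤ 1 - p k := by linarith [(hp k hk).2]
    rw [hg]
    positivity
  have hsub : ∑ k ∈ Finset.range 2, (m.choose k : ℝ) * H.redShare ^ k *
      (1 - H.redShare) ^ (m - k) * g k ≤ binomialMean m H.redShare g := by
    refine Finset.sum_le_sum_of_subset_of_nonneg (by simpa using by omega) fun k hk _ => ?_
    have := hg0 k (by simpa [Nat.lt_succ_iff] using hk)
    positivity
  refine le_trans ?_ hsub
  rw [Finset.sum_range_succ, Finset.sum_range_one]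
  simp only [Nat.choose_zero_right, Nat.cast_one, pow_zero, mul_one, one_mul, Nat.sub_zero,
    Nat.choose_one_right, pow_one]
  have hb0 : a ^ m ≤ (1 - H.redShare) ^ m := by gcongr
  have hm1 : (1 : ℝ) ≤ m := by exact_mod_cast (by omega : 1 ≤ m)
  have hb1 : a ^ m ≤ m * H.redShare * (1 - H.redShare) ^ (m - 1) := by
    calc a ^ m = 1 * a * a ^ (m - 1) := by
          rw [one_mul, ← pow_succ']
          congr 1
          omega
      _ ≤ _ := by gcongr
  have hsum : 1 / 2 ≤ g 0 + g 1 := by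
    obtain ⟨h00, h01⟩ := hp 0 (by omega)
    obtain ⟨h10, h11⟩ := hp 1 (by omega)
    have hm2 : (2 : ℝ) ≤ m := by exact_mod_cast hm
    have e : g 0 + g 1 = p 0 * p 1 * ((m - t) ^ 2 + (1 + m - t) ^ 2) +
        p 0 * (1 - p 1) * ((m - t) ^ 2 + (1 - t) ^ 2) +
        (1 - p 0) * p 1 * (t ^ 2 + (1 + m - t) ^ 2) +
        (1 - p 0) * (1 - p 1) * (t ^ 2 + (1 - t) ^ 2) := by
      rw [hg]
      push_cast
      ring
    have q1 : 1 / 2 ≤ (m - t) ^ 2 + (1 + m - t) ^ 2 := by nlinarith [sq_nonneg (2 * (m - t) + 1)]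
    have q2 : 1 / 2 ≤ (m - t) ^ 2 + (1 - t) ^ 2 := by nlinarith [sq_nonneg (m - t + (1 - t))]
    have q3 : 1 / 2 ≤ t ^ 2 + (1 + m - t) ^ 2 := by nlinarith [sq_nonneg (1 + m - 2 * t)]
    have q4 : 1 / 2 ≤ t ^ 2 + (1 - t) ^ 2 := by nlinarith [sq_nonneg (1 - 2 * t)]
    have c1 : 0 ≤ p 0 * p 1 := mul_nonneg h00 h10
    have c2 : 0 ≤ p 0 * (1 - p 1) := mul_nonneg h00 (by linarith)
    have c3 : 0 ≤ (1 - p 0) * p 1 := mul_nonneg (by linarith) h10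
    have c4 : 0 ≤ (1 - p 0) * (1 - p 1) := mul_nonneg (by linarith) (by linarith)
    rw [e]
    linarith [mul_le_mul_of_nonneg_left q1 c1, mul_le_mul_of_nonneg_left q2 c2,
      mul_le_mul_of_nonneg_left q3 c3, mul_le_mul_of_nonneg_left q4 c4]
  have := mul_le_mul_of_nonneg_right hb0 (hg0 0 (by omega))
  have := mul_le_mul_of_nonneg_right hb1 (hg0 1 (by omega))
  have : 0 ≤ a ^ m := by positivity
  nlinarith

theorem abs_redDegree_addNode_sub_le (H : ColoredGraph) {m : ℕ} (w : Fin m → Fin H.size)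
    (c : Bool) :
    |((H.addNode w c).redDegree : ℝ) - H.redDegree - 2 * m * H.redShare| ≤ 2 * m := by
  have h1 : ((H.addNode w c).redDegree : ℝ) ≤ H.redDegree + 2 * m := by
    have := redNeighbors_le H w
    rw [redDegree_addNode]
    exact_mod_cast (by split_ifs <;> omega)
  have h2 : (H.redDegree : ℝ) ≤ (H.addNode w c).redDegree := by
    rw [redDegree_addNode]
    exact_mod_cast (by omega)
  have hm0 : (0 : ℝ) ≤ 2 * m := by positivity
  have h3 := mul_nonneg hm0 (redShare_nonneg H)
  have h4 := mul_le_of_le_one_right hm0 (redShare_le_one H)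
  exact abs_le.2 ⟨by linarith, by linarith⟩

/-- A Gaussian kernel around `z` at the red share of the degrees; its variance is proportional to
the variance that the remaining steps contribute, regularized by `η`. -/
noncomputable def gaussianPotential (m : ℕ) (v z η : ℝ) (H : ColoredGraph) : ℝ :=
  Real.exp (-(v / (128 * (m : ℝ) ^ 2) * Real.log (1 / H.totalDegree + η)) -
    (H.redShare - z) ^ 2 / (16 * m * (1 / H.totalDegree + η)))

theorem stepMean_gaussianPotential_le {m : ℕ} (hm : 1 ≤ m) {p : ℕ → ℝ}
    (hp : ∀ k ≤ m, p k ∈ Icc (0 : ℝ) 1) {H : ColoredGraph} {v z η : ℝ} (hη : 0 < η) (hv : 0 < v)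
    (hS : 2 * m ≤ H.totalDegree) (hSv : 4 * (m : ℝ) ^ 3 ≤ v * H.totalDegree)
    (hz : |H.redShare - z| ≤ 1) (hdrift : 0 ≤ (H.redShare - z) * driftPoly m p H.redShare)
    (hvar : v ≤ stepMean m p H
      fun K => ((K.redDegree : ℝ) - H.redDegree - 2 * m * H.redShare) ^ 2) :
    stepMean m p H (gaussianPotential m v z η) ≤ gaussianPotential m v z η H := by
  have hS0 : 0 < H.totalDegree := by omega
  have hm1 : (1 : ℝ) ≤ m := by exact_mod_cast hm
  have hS1 : 2 * (m : ℝ) ≤ H.totalDegree := by exact_mod_cast hS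
  have hX : (H.redDegree : ℝ) = H.redShare * H.totalDegree := by
    rw [redShare]
    field_simp
  have hexponent := gaussian_exponent_le (u := H.redShare - z) hm1 hS1 hη hv hSv
  have hpoly := stepMean_redDegree hm p hS0
  obtain ⟨S, hSdef⟩ : ∃ S : ℝ, S = H.totalDegree := ⟨_, rfl⟩
  obtain ⟨x, hx⟩ : ∃ x, x = H.redShare := ⟨_, rfl⟩
  obtain ⟨T, hT⟩ : ∃ T, T = S + 2 * m := ⟨_, rfl⟩
  obtain ⟨q, hq⟩ : ∃ q, q = 1 / T + η := ⟨_, rfl⟩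
  have hx0 : 0 ≤ x := hx ▸ redShare_nonneg H
  have hx1 : x ≤ 1 := hx ▸ redShare_le_one H
  rw [← hx, ← hSdef, ← hT, ← hq] at hexponent
  rw [← hx] at hz hdrift hvar hX hpoly
  rw [← hSdef] at hS1 hX
  have hT0 : 0 < T := by linarith
  have hq0 : 0 < q := by rw [hq]; positivity
  obtain ⟨L, hL⟩ : ∃ L, L = -(v / (128 * (m : ℝ) ^ 2) * Real.log q) := ⟨_, rfl⟩
  obtain ⟨c, hc⟩ : ∃ c, c = (x - z) ^ 2 / (8 * T ^ 2 * q ^ 2) +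
    (m : ℝ) ^ 2 / (8 * T ^ 4 * q ^ 2) := ⟨_, rfl⟩
  obtain ⟨C, hC⟩ : ∃ C, C = Real.exp L * Real.exp (-((x - z) ^ 2 / (16 * m * q))) := ⟨_, rfl⟩
  have hC0 : 0 < C := by rw [hC]; positivity
  let d : ColoredGraph → ℝ := fun K => (K.redDegree : ℝ) - H.redDegree - 2 * m * x
  have hstep : stepMean m p H (gaussianPotential m v z η) ≤ stepMean m p H fun K =>
      (C * (1 + c) + (-(C * (2 * (x - z) / T / (16 * m * q)))) * d K) +
        (-(C / (16 * m * q * T ^ 2))) * d K ^ 2 := by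
    refine stepMean_mono hp H fun w c' => ?_
    obtain ⟨D, hD⟩ : ∃ D : ℝ, D = d (H.addNode w c') := ⟨_, rfl⟩
    have hD' : ((H.addNode w c').redDegree : ℝ) = H.redDegree + 2 * m * x + D := by
      rw [hD]
      simp only [d]
      ring
    have hincr : |D| ≤ 2 * m := by
      have := abs_redDegree_addNode_sub_le H w c'
      rwa [hD', ← hx, add_assoc, add_sub_cancel_left, add_sub_cancel_left] at this
    have hshare : (H.addNode w c').redShare - z = (x - z) + D / T := by
      rw [redShare, hD', totalDegree_addNode]
      push_cast
      rw [← hSdef, hX, ← hT]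
      field_simp
      rw [hT]
      ring
    have hjump := exp_gaussian_jump_le (S := T) (r := q) (u := x - z) (d := D) hm1 (by linarith)
      (by rw [hq]; linarith) hz hincr
    rw [gaussianPotential, hshare, totalDegree_addNode]
    push_cast
    rw [← hSdef, ← hT, ← hq, sub_eq_add_neg, Real.exp_add, ← hL, ← hD]
    refine (mul_le_mul_of_nonneg_left hjump (Real.exp_pos L).le).trans (le_of_eq ?_)
    rw [← mul_assoc, ← hC, ← hc]
    field_simp
    ring
  have hmean : stepMean m p H d = 2 * m * driftPoly m p x := by
    have : d = fun K => (K.redDegree : ℝ) + (-(H.redDegree + 2 * m * x)) := by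
      ext K
      simp only [d]
      ring
    rw [this, stepMean_add, stepMean_const p hS0, hpoly]
    ring
  rw [stepMean_add, stepMean_add, stepMean_const p hS0, stepMean_const_mul, stepMean_const_mul,
    hmean] at hstep
  refine hstep.trans ?_
  rw [gaussianPotential, ← hSdef, ← hx]
  refine le_trans ?_ (Real.exp_le_exp.2 hexponent)
  have h1 : 0 ≤ C * (2 * (x - z) / T / (16 * m * q)) * (2 * m * driftPoly m p x) := by
    have : C * (2 * (x - z) / T / (16 * m * q)) * (2 * m * driftPoly m p x) =
        C * (2 / T / (16 * m * q)) * (2 * m) * ((x - z) * driftPoly m p x) := by ring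
    rw [this]
    positivity
  have h2 : C / (16 * m * q * T ^ 2) * v ≤ C / (16 * m * q * T ^ 2) *
      stepMean m p H (fun K => d K ^ 2) := mul_le_mul_of_nonneg_left hvar (by positivity)
  have hCexp : Real.exp (-(v / (128 * (m : ℝ) ^ 2) * Real.log q) -
      (x - z) ^ 2 / (16 * m * q)) = C := by
    rw [hC, hL, ← Real.exp_add, ← sub_eq_add_neg]
  rw [Real.exp_add, hCexp, ← hc]
  have h3 := mul_le_mul_of_nonneg_left
    (Real.add_one_le_exp (c - v / (16 * m * q * T ^ 2))) hC0.le
  have h4 : C * (c - v / (16 * m * q * T ^ 2) + 1) =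
      C * (1 + c) - C / (16 * m * q * T ^ 2) * v := by ring
  linarith

end ColoredGraph

theorem two_le_of_driftPoly_pos {m : ℕ} (hm : 1 ≤ m) {p : ℕ → ℝ}
    (hp : ∀ k ≤ m, p k ∈ Icc (0 : ℝ) 1) {x z : ℝ} (hz : driftPoly m p z = 0) (hzx : z < x)
    (hx : 0 < driftPoly m p x) : 2 ≤ m := by
  by_contra h
  obtain rfl : m = 1 := by omega
  have hformula : ∀ y, 2 * driftPoly 1 p y = (1 - y) * p 0 + y * p 1 - y := by
    intro y
    have := driftPoly_eq_binomialMean le_rfl p y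
    simp only [binomialMean, Finset.sum_range_succ] at this
    norm_num at this
    linarith
  have h1 := hformula x
  have h2 := hformula z
  have h3 := (hp 0 (by omega)).1
  have h4 := (hp 1 le_rfl).2
  nlinarith [mul_nonneg (sub_pos.2 hzx).le (by linarith : 0 ≤ 1 - p 1 + p 0)]

namespace IsTypeAdoptionProcess

variable {Ω : Type*} [mΩ : MeasurableSpace Ω] {μ : Measure Ω} [IsProbabilityMeasure μ]
  {ℱ : Filtration ℕ mΩ} {m : ℕ} {p : ℕ → ℝ} {G₀ : ColoredGraph} {G : ℕ → Ω → ColoredGraph}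

theorem ae_not_tendsto_redShare_of_repelling (hG : IsTypeAdoptionProcess μ ℱ m p G₀ G)
    (hm : 1 ≤ m) (hp : ∀ k ≤ m, p k ∈ Icc (0 : ℝ) 1) {z : ℝ} (hz : z ∈ Ioo (0 : ℝ) 1)
    (hPz : driftPoly m p z = 0) {ε : ℝ} (hε : 0 < ε)
    (hneg : ∀ x ∈ Ioo (z - ε) z, driftPoly m p x < 0)
    (hpos : ∀ x ∈ Ioo z (z + ε), 0 < driftPoly m p x) :
    ∀ᵐ ω ∂μ, ¬Tendsto (fun n => (G n ω).redShare) atTop (𝓝 z) := by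
  have hm2 : 2 ≤ m := two_le_of_driftPoly_pos hm hp hPz (by linarith : z < z + ε / 2)
    (hpos _ ⟨by linarith, by linarith⟩)
  have hm0 : (0 : ℝ) < m := by positivity
  obtain ⟨a, ha0, haz, haz'⟩ : ∃ a > 0, 2 * a ≤ z ∧ 2 * a ≤ 1 - z := by
    refine ⟨min z (1 - z) / 2, by have := lt_min hz.1 (sub_pos.2 hz.2); positivity, ?_, ?_⟩
    · linarith [min_le_left z (1 - z)]
    · linarith [min_le_right z (1 - z)]
  obtain ⟨δ, hδ0, hδε, hδa⟩ : ∃ δ > 0, δ ≤ ε ∧ δ ≤ a :=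
    ⟨min ε a, lt_min hε ha0, min_le_left _ _, min_le_right _ _⟩
  obtain ⟨v, hv⟩ : ∃ v : ℝ, v = a ^ m / 2 := ⟨_, rfl⟩
  have hv0 : 0 < v := by rw [hv]; positivity
  obtain ⟨α, hα⟩ : ∃ α : ℝ, α = v / (128 * (m : ℝ) ^ 2) := ⟨_, rfl⟩
  have hα0 : 0 < α := by rw [hα]; positivity
  let W : Set ColoredGraph := {H | |H.redShare - z| < δ ∧ 2 * m ≤ H.totalDegree ∧
    4 * (m : ℝ) ^ 3 ≤ v * H.totalDegree}
  have hWmem : ∀ H, H ∈ W ↔ |H.redShare - z| < δ ∧ 2 * m ≤ H.totalDegree ∧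
    4 * (m : ℝ) ^ 3 ≤ v * H.totalDegree := fun H => Iff.rfl
  have hW : ∀ η > 0, ∀ H ∈ W, stepMean m p H (gaussianPotential m v z η) ≤
      gaussianPotential m v z η H := by
    intro η hη H hH
    obtain ⟨h1, h2, h3⟩ := (hWmem H).1 hH
    have h4 := abs_lt.1 h1
    refine stepMean_gaussianPotential_le hm hp hη hv0 h2 h3 ?_ ?_ ?_
    · linarith [hz.2, h1]
    · rcases lt_trichotomy H.redShare z with h | h | h
      · exact mul_nonneg_of_nonpos_of_nonpos (by linarith)
          (hneg _ ⟨by linarith, h⟩).le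
      · rw [h, sub_self, zero_mul]
      · exact mul_nonneg (by linarith) (hpos _ ⟨h, by linarith⟩).le
    · rw [hv]
      exact le_stepMean_sq hm2 hp (by omega) ha0.le (by linarith) (by linarith) _
  have hnull : ∀ N, ∀ᵐ ω ∂μ, (∀ n, N ≤ n → G n ω ∈ W) →
      ¬Tendsto (fun n => (G n ω).redShare) atTop (𝓝 z) := by
    intro N
    let E : Set Ω := {ω | (∀ n, N ≤ n → G n ω ∈ W) ∧
      Tendsto (fun n => (G n ω).redShare) atTop (𝓝 z)}
    have hE : ∀ ω, ω ∈ E ↔ (∀ n, N ≤ n → G n ω ∈ W) ∧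
      Tendsto (fun n => (G n ω).redShare) atTop (𝓝 z) := fun ω => Iff.rfl
    obtain ⟨B, hB⟩ : ∃ B : ℝ,
      B = Real.exp (α * Real.log ((G₀.totalDegree + 2 * m * N : ℕ) : ℝ)) := ⟨_, rfl⟩
    have hbound : ∀ η > 0, ENNReal.ofReal (Real.exp (-(α * Real.log η))) * μ E ≤
        ENNReal.ofReal B := by
      intro η hη
      have hlim := mul_measure_le_of_stepMean_le hG hp
        (ψ := gaussianPotential m v z η) (fun H => (Real.exp_pos _).le) (hW η hη) N (E := E)
        (c := ENNReal.ofReal (Real.exp (-(α * Real.log η)))) (by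
          filter_upwards [ae_tendsto_totalDegree hG hm hp] with ω hω hωE
          obtain ⟨h1, h2⟩ := (hE ω).1 hωE
          refine ⟨h1, ENNReal.tendsto_ofReal ((Real.continuous_exp.tendsto _).comp ?_)⟩
          have h3 : Tendsto (fun n => 1 / ((G n ω).totalDegree : ℝ) + η) atTop (𝓝 η) := by
            have := (tendsto_inv_atTop_zero.comp hω).add_const η
            simpa [Function.comp_def] using this
          have h4 := ((h3.log hη.ne').const_mul α).neg
          have h5 := ((h2.sub_const z).pow 2).div (h3.const_mul (16 * (m : ℝ))) (by positivity)
          have h6 := h4.sub h5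
          simp only [sub_self, ne_eq, OfNat.ofNat_ne_zero, not_false_eq_true, zero_pow, zero_div,
            sub_zero] at h6
          rw [← hα]
          exact h6)
      refine hlim.trans ?_
      calc _ ≤ ∫⁻ _ω in G N ⁻¹' W, ENNReal.ofReal B ∂μ := by
            refine setLIntegral_mono_ae' (hG.measurable N trivial) ?_
            filter_upwards [ae_totalDegree hG hp] with ω hω hωW
            refine ENNReal.ofReal_le_ofReal ?_
            have h2 := ((hWmem _).1 hωW).2.1
            have hS : (0 : ℝ) < (G N ω).totalDegree := by
              exact_mod_cast (by omega : 0 < (G N ω).totalDegree)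
            rw [gaussianPotential, hB, ← hω N, ← hα]
            refine Real.exp_le_exp.2 ?_
            have h3 : -Real.log ((G N ω).totalDegree : ℝ) ≤
                Real.log (1 / (G N ω).totalDegree + η) := by
              rw [← Real.log_inv, ← one_div]
              exact Real.log_le_log (by positivity) (by linarith)
            have h4 : 0 ≤ ((G N ω).redShare - z) ^ 2 /
                (16 * m * (1 / (G N ω).totalDegree + η)) := by positivity
            nlinarith [mul_le_mul_of_nonneg_left h3 hα0.le]
        _ ≤ ENNReal.ofReal B * 1 := by
            rw [setLIntegral_const]
            gcongr
            exact prob_le_one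
        _ = _ := mul_one _
    have hzero : μ E = 0 := by
      by_contra hne
      have hpos' : 0 < (μ E).toReal := ENNReal.toReal_pos hne (measure_ne_top _ _)
      have hexp : ∀ t : ℝ, Real.exp (α * t) * (μ E).toReal ≤ B := by
        intro t
        have h1 := hbound (Real.exp (-t)) (Real.exp_pos _)
        rw [Real.log_exp, mul_neg, neg_neg, ← ENNReal.ofReal_toReal (measure_ne_top μ E),
          ← ENNReal.ofReal_mul (Real.exp_pos _).le,
          ENNReal.ofReal_le_ofReal_iff (by rw [hB]; positivity)] at h1
        exact h1
      have h1 := hexp (B / (μ E).toReal / α)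
      have h2 := Real.add_one_le_exp (α * (B / (μ E).toReal / α))
      have h3 : α * (B / (μ E).toReal / α) = B / (μ E).toReal := by field_simp
      rw [h3] at h1 h2
      have h4 : B / (μ E).toReal * (μ E).toReal = B := by field_simp
      nlinarith [mul_le_mul_of_nonneg_right h2 hpos'.le]
    filter_upwards [measure_eq_zero_iff_ae_notMem.1 hzero] with ω hω h4 h5
    exact hω ((hE ω).2 ⟨h4, h5⟩)
  filter_upwards [ae_all_iff.2 hnull, ae_tendsto_totalDegree hG hm hp] with ω h1 h2 h3
  have hev : ∀ᶠ n in atTop, G n ω ∈ W := by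
    filter_upwards [(Metric.tendsto_nhds.1 h3) δ hδ0, h2.eventually_ge_atTop (2 * (m : ℝ)),
      h2.eventually_ge_atTop (4 * (m : ℝ) ^ 3 / v)] with n e1 e2 e3
    refine (hWmem _).2 ⟨e1, by exact_mod_cast e2, ?_⟩
    rw [div_le_iff₀ hv0] at e3
    linarith
  obtain ⟨N, hN⟩ := eventually_atTop.1 hev
  exact h1 N hN h3

end IsTypeAdoptionProcess

theorem theorem4 {Ω : Type*} [mΩ : MeasurableSpace Ω] (μ : Measure Ω) [IsProbabilityMeasure μ]
    (ℱ : Filtration ℕ mΩ) (m : ℕ) (hm : 1 ≤ m)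
    (p : ℕ → ℝ) (hp : ∀ k ≤ m, p k ∈ Icc (0 : ℝ) 1)
    (hnonlin : ∃ k ≤ m, p k ≠ (k : ℝ) / (m : ℝ))
    (G₀ : ColoredGraph) (hX₀ : 0 < G₀.redDegree) (hY₀ : 0 < G₀.blueDegree)
    (G : ℕ → Ω → ColoredGraph) (hG : IsTypeAdoptionProcess μ ℱ m p G₀ G) :
    (∀ z ∈ driftZeros m p ∩ Ioo (0 : ℝ) 1,
      (∃ ε > 0, (∀ x ∈ Ioo (z - ε) z, driftPoly m p x < 0) ∧
        ∀ x ∈ Ioo z (z + ε), 0 < driftPoly m p x) →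
      μ {ω | Tendsto (fun n => (G n ω).redFraction) atTop (𝓝 z)} = 0) ∧
    ((0 : ℝ) ∈ driftZeros m p → (∃ ε > 0, ∀ x ∈ Ioo (0 : ℝ) ε, 0 < driftPoly m p x) →
      μ {ω | Tendsto (fun n => (G n ω).redFraction) atTop (𝓝 0)} = 0) ∧
    ((1 : ℝ) ∈ driftZeros m p → (∃ ε > 0, ∀ x ∈ Ioo (1 - ε) (1 : ℝ), driftPoly m p x < 0) →
      μ {ω | Tendsto (fun n => (G n ω).redFraction) atTop (𝓝 1)} = 0) :=
 by
  have hS₀ : 0 < G₀.totalDegree := by unfold totalDegree; omega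
  have transfer : ∀ z, (∀ᵐ ω ∂μ, ¬Tendsto (fun n => (G n ω).redShare) atTop (𝓝 z)) →
      μ {ω | Tendsto (fun n => (G n ω).redFraction) atTop (𝓝 z)} = 0 := by
    intro z h
    rw [measure_eq_zero_iff_ae_notMem]
    filter_upwards [h, hG.ae_tendsto_redShare hm hp hS₀ (z := z)] with ω h1 h2 h3
    exact h1 (h2 h3)
  refine ⟨?_, ?_, ?_⟩
  · rintro z ⟨hz, hz'⟩ ⟨ε, hε, hneg, hpos⟩
    exact transfer z (hG.ae_not_tendsto_redShare_of_repelling hm hp hz' hz.2 hε hneg hpos)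
  · rintro - ⟨ε, hε, hpos⟩
    exact transfer 0 (hG.ae_not_tendsto_redShare_zero hm hp hX₀ hε hpos)
  · rintro - ⟨ε, hε, hneg⟩
    exact transfer 1 (hG.ae_not_tendsto_redShare_one hm hp hY₀ hε hneg)
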